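/- Let $\alpha\in(0,\tfrac13)$, let $p_1=(0,0)$, $p_2=(\tfrac12,\tfrac{\sqrt3}2)$, $p_3=(1,0)$, $p_4=\tfrac{p_2+p_3}2$, $p_5=\tfrac{p_1+p_3}2$, $p_6=\tfrac{p_1+p_2}2$, and let $F_j(x)=A_j(x-p_j)+p_j$ on $\mathbb R^2$, where $A_1=A_2=A_3=\tfrac{1-\alpha}2 I$ and $$A_4=\tfrac{\alpha}{4}\begin{pmatrix}1&-\sqrt3\\-\sqrt3&3\end{pmatrix},\quad A_5=\alpha\begin{pmatrix}1&0\\0&0\end{pmatrix},\quad A_6=\tfrac{\alpha}{4}\begin{pmatrix}1&\sqrt3\\\sqrt3&3\end{pmatrix}.$$ The stretched Sierpinski gasket $K_\alpha\subset\mathbb R^2$ is the unique non-empty compact set with $K_\alpha=\bigcup_{j=1}^6F_j(K_\alpha)$. Its edges are, for every finite word $w$ in the letters $1,2,3$ (with $F_w$ the corresponding composition), the three sides of the triangle with vertices $F_w(p_1),F_w(p_2),F_w(p_3)$ and the three joining edges $F_w(\overline{e_i})$, where $\overline{e_i}$ ($i=1,2,3$) is the segment with end points $F_{i+3}(p_k)$,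 $k\in\{1,2,3\}\setminus\{i\}$. Let $\mathscr E$ be the countable set of all edges, and for $\epsilon\in\mathscr E$ let $R_\epsilon:[0,\ell_\epsilon]\to K_\alpha$ be its parametrization by arc length. For $\epsilon\in\mathscr E$ let $H_\epsilon=L^2([-\ell_\epsilon,\ell_\epsilon],(2\ell_\epsilon)^{-1}dx)$, let $\pi_\epsilon(f)h(x)=f(R_\epsilon(|x|))h(x)$ for $f\in C(K_\alpha)$ (complex-valued), and let $D_\epsilon=-i\frac{d}{dx}+\frac{\pi}{2\ell_\epsilon}$ with periodic boundary conditions, i.e. the self-adjoint operator with eigenvalue $\frac{(2k+1)\pi}{2\ell_\epsilon}$ on $e^{i\pi kx/\ell_\epsilon}$, $k\in\mathbb Z$. Let $H_\alpha=\bigoplus_\epsilon H_\epsilon$, $\pi_\alpha=\bigoplus_\epsilon\pi_\epsilon$, $D_\alpha=\bigoplus_\epsilon D_\epsilon$ (Hilbert space direct sums). The inequality $\|[D_\alpha,\pi_\alpha(f)]\|\le1$ means that $\pi_\alpha(f)$ maps $\mathrm{Dom}(D_\alpha)$ into itself and $\|D_\alpha\pi_\alpha(f)h-\pi_\alpha(f)D_\alpha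 h\|\le\|h\|$ for all $h\in\mathrm{Dom}(D_\alpha)$. Put $$d_{K_\alpha}(x,y)=\sup\{|f(x)-f(y)|: f\in C(K_\alpha),\ \|[D_\alpha,\pi_\alpha(f)]\|\le1\},$$ and let $d_{geo}(x,y)$ be the infimum of the Euclidean lengths of the continuous paths in $K_\alpha$ from $x$ to $y$. Then for all $x,y\in K_\alpha$, $$d_{K_\alpha}(x,y)=d_{geo}(x,y)<\infty .$$ Moreover, the Lapidus–Sarhad Axiom 2 fails for $K_\alpha$ and the curves $R_\epsilon$: there is no dense set $B\subset K_\alpha$ such that for all $p\in B$ and $q\in K_\alpha$ one of the minimizing geodesics (paths of length $d_{geo}(p,q)$) from $p$ to $q$ is a finite or countable concatenation of curves $R_\epsilon$, each run through once in either direction. -/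

import Mathlib

open scoped ENNReal NNReal

noncomputable section

/-! ## Unbounded operators, spectral distance -/

namespace SpectralTriple

section Abstract

variable {H : Type*} [NormedAddCommGroup H] [InnerProductSpace ℂ H]

/-- `‖[D, A]‖ ≤ c` for an unbounded operator `D` and a bounded operator `A`: the operator `A` maps
`Dom D` into itself (so that the commutator `DA - AD` is defined on `Dom D`), and `[D, A]` is
bounded by `c` there. When `Dom D` is dense this says that `[D, A]` extends to a bounded operator
on `H` of norm at most `c`. -/
def CommutatorNormLE (D : H →ₗ.[ℂ] H) (A : H →L[ℂ] H) (c : ℝ) : Prop :=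
  ∀ h : D.domain, ∃ hA : A h ∈ D.domain, ‖D ⟨A h, hA⟩ - A (D h)‖ ≤ c * ‖(h : H)‖

/-- The spectral distance
`d_X(x, y) = sup {|f x - f y| : f ∈ C(X), ‖[D, π(f)]‖ ≤ 1}`, with values in `[0, ∞]`. -/
def spectralDist {X : Type*} [TopologicalSpace X]
    (π : C(X, ℂ) → (H →L[ℂ] H)) (D : H →ₗ.[ℂ] H) (x y : X) : ℝ≥0∞ :=
  ⨆ (f : C(X, ℂ)) (_ : CommutatorNormLE D (π f) 1), ENNReal.ofReal ‖f x - f y‖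

/-- The domain `{h | ∑ |ev k|² |⟨b k, h⟩|² < ∞}` of the operator `diagonalOp b ev`. -/
def diagonalDomain {κ : Type*} (b : HilbertBasis κ ℂ H) (ev : κ → ℝ) : Submodule ℂ H where
  carrier := {h | Memℓp (fun k => (ev k : ℂ) * b.repr h k) 2}
  add_mem' := by
    intro x y hx hy
    have h := Memℓp.add hx hy
    refine cast (congrArg (fun f => Memℓp f 2) ?_) h
    funext k
    simp [mul_add]
  zero_mem' := by
    refine cast (congrArg (fun f => Memℓp f 2) ?_) (zero_memℓp (E := fun _ : κ => ℂ) (p := 2))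
    funext k
    simp
  smul_mem' := by
    intro c x hx
    have h := Memℓp.const_smul hx c
    refine cast (congrArg (fun f => Memℓp f 2) ?_) h
    funext k
    simp [mul_left_comm]

/-- The self-adjoint operator with eigenvalues `ev k` on the Hilbert basis `b`, which sends `h` to
`∑ ev k ⟨b k, h⟩ b k`. -/
def diagonalOp {κ : Type*} (b : HilbertBasis κ ℂ H) (ev : κ → ℝ) : H →ₗ.[ℂ] H where
  domain := diagonalDomain b ev
  toFun :=
    { toFun := fun h => b.repr.symm ⟨fun k => (ev k : ℂ) * b.repr (h : H) k, h.2⟩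
      map_add' := by
        intro x y
        refine b.repr.injective ?_
        ext k
        simp only [map_add, LinearIsometryEquiv.apply_symm_apply, lp.coeFn_add, Pi.add_apply,
          Submodule.coe_add]
        exact mul_add _ _ _
      map_smul' := by
        intro c x
        refine b.repr.injective ?_
        ext k
        simp only [map_smul, LinearIsometryEquiv.apply_symm_apply, lp.coeFn_smul, Pi.smul_apply,
          Submodule.coe_smul, RingHom.id_apply, smul_eq_mul]
        exact mul_left_comm _ _ _ }

end Abstract

section DirectSum

variable {ι : Type*} {G : ι → Type*} [∀ i, NormedAddCommGroup (G i)]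
  [∀ i, InnerProductSpace ℂ (G i)]

/-- The orthogonal direct sum `⊕ D i` on the Hilbert space direct sum `⊕ G i`: its domain consists
of the `h` with `h i ∈ Dom (D i)` for all `i` and `∑ ‖D i (h i)‖² < ∞`. -/
def directSumOp (D : ∀ i, G i →ₗ.[ℂ] G i) : lp G 2 →ₗ.[ℂ] lp G 2 where
  domain :=
    { carrier := {h | ∃ hd : ∀ i, h i ∈ (D i).domain, Memℓp (fun i => D i ⟨h i, hd i⟩) 2}
      add_mem' := by
        rintro x y ⟨hx, hx2⟩ ⟨hy, hy2⟩
        refine ⟨fun i => (D i).domain.add_mem (hx i) (hy i), ?_⟩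
        have h := hx2.add hy2
        refine cast (congrArg (fun f => Memℓp f 2) ?_) h
        funext i
        exact ((D i).map_add ⟨x i, hx i⟩ ⟨y i, hy i⟩).symm
      zero_mem' := by
        refine ⟨fun i => (D i).domain.zero_mem, ?_⟩
        refine cast (congrArg (fun f => Memℓp f 2) ?_) (zero_memℓp (E := G) (p := 2))
        funext i
        exact ((D i).map_zero).symm
      smul_mem' := by
        rintro c x ⟨hx, hx2⟩
        refine ⟨fun i => (D i).domain.smul_mem c (hx i), ?_⟩
        have h := hx2.const_smul c
        refine cast (congrArg (fun f => Memℓp f 2) ?_) h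
        funext i
        exact ((D i).map_smul c ⟨x i, hx i⟩).symm }
  toFun :=
    { toFun := fun h => ⟨fun i => D i ⟨(h : lp G 2) i, h.2.1 i⟩, h.2.2⟩
      map_add' := by
        intro x y
        ext i
        exact (D i).map_add ⟨(x : lp G 2) i, x.2.1 i⟩ ⟨(y : lp G 2) i, y.2.1 i⟩
      map_smul' := by
        intro c x
        ext i
        exact (D i).map_smul c ⟨(x : lp G 2) i, x.2.1 i⟩ }

end DirectSum

/-! ## The spectral triple of a curve

Functions on `[-ℓ, ℓ]` are regarded as `2ℓ`-periodic functions, that is, as functions on the circle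
`ℝ / 2ℓℤ`. -/

section Curve

variable {X : Type*} [TopologicalSpace X] (ℓ : ℝ) [hℓ : Fact (0 < ℓ)]

instance instFactTwoMulPos : Fact (0 < 2 * ℓ) := ⟨mul_pos two_pos hℓ.out⟩

/-- `L²([-ℓ, ℓ], (2ℓ)⁻¹ m)`, as the `L²` space of the circle `ℝ / 2ℓℤ` with its Lebesgue measure
normalized to total mass one. -/
abbrev CurveSpace : Type :=
  MeasureTheory.Lp ℂ 2 (AddCircle.haarAddCircle (T := 2 * ℓ))

/-- `D_ℓ = -i d/dx + π/(2ℓ)` with periodic boundary conditions: the self-adjoint operator with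
eigenvalue `πk/ℓ + π/(2ℓ) = (2k+1)π/(2ℓ)` on the function `φ_k(x) = exp(iπkx/ℓ)`. -/
def curveDirac : CurveSpace ℓ →ₗ.[ℂ] CurveSpace ℓ :=
  diagonalOp (fourierBasis (T := 2 * ℓ)) fun k : ℤ => (2 * (k : ℝ) + 1) * Real.pi / (2 * ℓ)

variable {ℓ}

/-- Multiplication by a continuous function. -/
def mulOp (g : C(AddCircle (2 * ℓ), ℂ)) : CurveSpace ℓ →L[ℂ] CurveSpace ℓ :=
  (ContinuousLinearMap.mul ℂ ℂ).holderL (AddCircle.haarAddCircle (T := 2 * ℓ)) ∞ 2 2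
    (ContinuousMap.toLp ∞ (AddCircle.haarAddCircle (T := 2 * ℓ)) ℂ g)

theorem mulOp_apply_ae (g : C(AddCircle (2 * ℓ), ℂ)) (h : CurveSpace ℓ) :
    mulOp g h =ᵐ[AddCircle.haarAddCircle (T := 2 * ℓ)] fun x => g x * h x := by
  have h1 := (ContinuousLinearMap.mul ℂ ℂ).coeFn_holder (r := 2)
    (ContinuousMap.toLp ∞ (AddCircle.haarAddCircle (T := 2 * ℓ)) ℂ g) h
  have h2 := ContinuousMap.coeFn_toLp (p := ∞) (μ := AddCircle.haarAddCircle (T := 2 * ℓ))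
    (𝕜 := ℂ) g
  filter_upwards [h1, h2] with x hx1 hx2
  rw [mulOp, ContinuousLinearMap.holderL_apply_apply, hx1, hx2]
  rfl

theorem norm_mulOp_le (g : C(AddCircle (2 * ℓ), ℂ)) : ‖mulOp g‖ ≤ ‖g‖ := by
  refine ContinuousLinearMap.opNorm_le_bound _ (norm_nonneg _) fun h => ?_
  refine MeasureTheory.Lp.norm_le_mul_norm_of_ae_le_mul ?_
  filter_upwards [mulOp_apply_ae g h] with x hx
  rw [hx, norm_mul]
  exact mul_le_mul_of_nonneg_right (g.norm_coe_le_norm x) (norm_nonneg _)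

/-- The map `x ↦ R(|x|)` on `[-ℓ, ℓ]`, extended periodically. The norm of the class of
`x ∈ [-ℓ, ℓ]` in `ℝ / 2ℓℤ` is `|x|`. -/
def foldedCurve (R : C(Set.Icc (0 : ℝ) ℓ, X)) : C(AddCircle (2 * ℓ), X) where
  toFun x := R ⟨‖x‖, norm_nonneg x, by
    have h := AddCircle.norm_le_half_period (2 * ℓ) (x := x) (mul_pos two_pos hℓ.out).ne'
    rw [abs_of_pos (mul_pos two_pos hℓ.out)] at h
    linarith⟩
  continuous_toFun := R.continuous.comp (continuous_norm.subtype_mk _)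

/-- The representation `π_ℓ(f) h (x) = f(R(|x|)) h(x)` of `C(X)` on `L²([-ℓ, ℓ])`. -/
def curveRep (R : C(Set.Icc (0 : ℝ) ℓ, X)) (f : C(X, ℂ)) : CurveSpace ℓ →L[ℂ] CurveSpace ℓ :=
  mulOp (f.comp (foldedCurve R))

theorem norm_curveRep_le [CompactSpace X] (R : C(Set.Icc (0 : ℝ) ℓ, X)) (f : C(X, ℂ)) :
    ‖curveRep R f‖ ≤ ‖f‖ :=
  (norm_mulOp_le _).trans
    ((ContinuousMap.norm_le _ (norm_nonneg f)).2 fun _ => f.norm_coe_le_norm _)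

end Curve

/-! ## The direct sum of the spectral triples of a family of curves -/

section CurveSum

variable {X : Type*} [TopologicalSpace X] {ι : Type*} (ℓ : ι → ℝ) [∀ i, Fact (0 < ℓ i)]

/-- The Hilbert space direct sum of the spaces `L²([-ℓ i, ℓ i])`. -/
abbrev CurveSumSpace : Type _ := lp (fun i => CurveSpace (ℓ i)) 2

/-- The direct sum of the operators `D_{ℓ i}`. -/
def curveSumDirac : CurveSumSpace ℓ →ₗ.[ℂ] CurveSumSpace ℓ :=
  directSumOp fun i => curveDirac (ℓ i)

variable {ℓ}

/-- The direct sum of the representations of `C(X)` given by the curves `R i`. -/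
def curveSumRep [CompactSpace X] (R : ∀ i, C(Set.Icc (0 : ℝ) (ℓ i), X)) (f : C(X, ℂ)) :
    CurveSumSpace ℓ →L[ℂ] CurveSumSpace ℓ :=
  lp.mapCLM 2 (fun i => curveRep (R i) f) (norm_nonneg f) fun i => norm_curveRep_le (R i) f

end CurveSum

end SpectralTriple

/-! ## Lengths of paths, geodesics -/

namespace LengthSpace

variable {X : Type*} [PseudoEMetricSpace X]

/-- The length of a path. -/
def pathLength {x y : X} (γ : Path x y) : ℝ≥0∞ := eVariationOn γ Set.univ

/-- The geodesic distance: the infimum of the lengths of the paths from `x` to `y` in `X`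
(`∞` if there is no rectifiable path). -/
def geodesicDist (x y : X) : ℝ≥0∞ := ⨅ γ : Path x y, pathLength γ

/-- A path of finite length which is shortest among all paths with the same endpoints. -/
def IsMinimizingGeodesic {x y : X} (γ : Path x y) : Prop :=
  pathLength γ = geodesicDist x y ∧ pathLength γ ≠ ∞

variable {ι : Type*} {ℓ : ι → ℝ}

/-- `γ` restricted to `[a, b]` runs once through the curve `R`, in either direction. -/
def Traverses {x y : X} (γ : Path x y) (a b : unitInterval) {l : ℝ}
    (R : C(Set.Icc (0 : ℝ) l, X)) : Prop :=
  ∃ φ : unitInterval → Set.Icc (0 : ℝ) l,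
    (MonotoneOn φ (Set.Icc a b) ∨ AntitoneOn φ (Set.Icc a b)) ∧
    φ '' Set.Icc a b = Set.univ ∧ ∀ s ∈ Set.Icc a b, γ s = R (φ s)

/-- `γ` is a finite or countable concatenation of curves of the family `R`. The path may pause
(which covers finite concatenations, and the constant path as the empty concatenation). -/
def IsConcatenation {x y : X} (γ : Path x y) (R : ∀ i, C(Set.Icc (0 : ℝ) (ℓ i), X)) : Prop :=
  ∃ t : ℕ → unitInterval, t 0 = 0 ∧ Monotone t ∧ Filter.Tendsto t Filter.atTop (nhds 1) ∧
    ∀ n, (∀ s ∈ Set.Icc (t n) (t (n + 1)), γ s = γ (t n)) ∨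
      ∃ i, Traverses γ (t n) (t (n + 1)) (R i)

/-- The second axiom of Lapidus and Sarhad for the family of curves `R`: there is a dense set `B`
such that for all `p ∈ B` and all `q`, one of the minimizing geodesics from `p` to `q` is a finite
or countable concatenation of curves of the family. -/
def LapidusSarhadAxiomTwo (R : ∀ i, C(Set.Icc (0 : ℝ) (ℓ i), X)) : Prop :=
  ∃ B : Set X, Dense B ∧ ∀ p ∈ B, ∀ q : X, ∃ γ : Path p q,
    IsMinimizingGeodesic γ ∧ IsConcatenation γ R

end LengthSpace

/-! ## The stretched Sierpinski gasket -/

namespace StretchedGasket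

/-- The Euclidean plane. -/
abbrev Plane : Type := EuclideanSpace ℝ (Fin 2)

/-- The vertices of the triangle. -/
def vertex : Fin 3 → Plane := ![!₂[0, 0], !₂[1 / 2, √3 / 2], !₂[1, 0]]

/-- The centres of the six maps: the vertices, and the midpoints of the opposite sides. -/
def center : Fin 6 → Plane :=
  ![vertex 0, vertex 1, vertex 2,
    (1 / 2 : ℝ) • (vertex 1 + vertex 2), (1 / 2 : ℝ) • (vertex 0 + vertex 2),
    (1 / 2 : ℝ) • (vertex 0 + vertex 1)]

/-- The linear parts of the six maps. -/
def linPart (α : ℝ) : Fin 6 → Matrix (Fin 2) (Fin 2) ℝ :=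
  ![((1 - α) / 2) • !![1, 0; 0, 1], ((1 - α) / 2) • !![1, 0; 0, 1],
    ((1 - α) / 2) • !![1, 0; 0, 1],
    (α / 4) • !![1, -√3; -√3, 3], α • !![1, 0; 0, 0], (α / 4) • !![1, √3; √3, 3]]

/-- The maps `F_j(x) = A_j (x - p_j) + p_j`. The first three are the similarities at the corners,
the last three collapse the triangle to the joining edges. -/
def F (α : ℝ) (j : Fin 6) (x : Plane) : Plane :=
  Matrix.toEuclideanLin (linPart α j) (x - center j) + center j

/-- The similarities `F_1, F_2, F_3`. -/
def cornerMap (α : ℝ) (i : Fin 3) : Plane → Plane := F α (Fin.castAdd 3 i)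

/-- The maps `F_4, F_5, F_6`; the `i`-th one maps the triangle onto the joining edge on the side
opposite to `vertex i`. -/
def joinMap (α : ℝ) (i : Fin 3) : Plane → Plane := F α (Fin.natAdd 3 i)

/-- The compositions `F_w`, where `w` is a word in the letters `1, 2, 3`. -/
def wordMap (α : ℝ) : List (Fin 3) → Plane → Plane
  | [] => id
  | i :: w => cornerMap α i ∘ wordMap α w

theorem F_sub (α : ℝ) (j : Fin 6) (x y : Plane) :
    F α j x - F α j y = Matrix.toEuclideanLin (linPart α j) (x - y) := by
  simp only [F, add_sub_add_right_eq_sub, ← map_sub, sub_sub_sub_cancel_right]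

theorem norm_linPart_le {α : ℝ} (h0 : 0 < α) (h1 : α < 1 / 3) (j : Fin 6) (v : Plane) :
    ‖Matrix.toEuclideanLin (linPart α j) v‖ ≤ (1 - α) / 2 * ‖v‖ := by
  have hc : 0 ≤ (1 - α) / 2 := by linarith
  have h3 : √3 * √3 = 3 := Real.mul_self_sqrt (by norm_num)
  rw [EuclideanSpace.norm_eq, EuclideanSpace.norm_eq, ← Real.sqrt_sq hc,
    ← Real.sqrt_mul (sq_nonneg _)]
  apply Real.sqrt_le_sqrt
  have ha : α ^ 2 ≤ ((1 - α) / 2) ^ 2 := by nlinarith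
  generalize hx : v 0 = x
  generalize hy : v 1 = y
  have hxy := mul_le_mul_of_nonneg_right ha (add_nonneg (sq_nonneg x) (sq_nonneg y))
  fin_cases j <;>
    simp [Fin.sum_univ_two, linPart, Matrix.mulVec, dotProduct, hx, hy]
  · exact le_of_eq (by ring)
  · exact le_of_eq (by ring)
  · exact le_of_eq (by ring)
  · refine le_trans ?_ hxy
    refine sub_nonneg.1 (le_of_le_of_eq (sq_nonneg (α / 2 * (√3 * x + y))) ?_)
    linear_combination (α ^ 2 / 16 * (4 * x ^ 2 + x ^ 2 + y ^ 2)) * h3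
  · refine le_trans ?_ hxy
    nlinarith [mul_nonneg (sq_nonneg α) (sq_nonneg y)]
  · refine le_trans ?_ hxy
    refine sub_nonneg.1 (le_of_le_of_eq (sq_nonneg (α / 2 * (√3 * x - y))) ?_)
    linear_combination (α ^ 2 / 16 * (4 * x ^ 2 + x ^ 2 + y ^ 2)) * h3

theorem lipschitzWith_F {α : ℝ} (h0 : 0 < α) (h1 : α < 1 / 3) (j : Fin 6) :
    LipschitzWith (Real.toNNReal ((1 - α) / 2)) (F α j) := by
  refine LipschitzWith.of_dist_le_mul fun x y => ?_
  rw [dist_eq_norm, F_sub, dist_eq_norm, Real.coe_toNNReal _ (by linarith)]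
  exact norm_linPart_le h0 h1 j _

/-- There is exactly one non-empty compact set `K` with `K = F_1(K) ∪ ⋯ ∪ F_6(K)`. -/
theorem existsUnique_gasket {α : ℝ} (h0 : 0 < α) (h1 : α < 1 / 3) :
    ∃! K : Set Plane, K.Nonempty ∧ IsCompact K ∧ K = ⋃ j, F α j '' K := by
  have hF := lipschitzWith_F h0 h1
  let Φ : TopologicalSpace.NonemptyCompacts Plane → TopologicalSpace.NonemptyCompacts Plane :=
    fun K => ⟨⟨⋃ j, F α j '' (K : Set Plane),
      isCompact_iUnion fun j => K.isCompact.image (hF j).continuous⟩,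
      Set.nonempty_iUnion.2 ⟨0, K.nonempty.image _⟩⟩
  have hΦ : ContractingWith (Real.toNNReal ((1 - α) / 2)) Φ := by
    refine ⟨by rw [Real.toNNReal_lt_one]; linarith, fun K L => ?_⟩
    change Metric.hausdorffEDist (⋃ j, F α j '' (K : Set Plane)) (⋃ j, F α j '' (L : Set Plane))
      ≤ _ * Metric.hausdorffEDist (K : Set Plane) L
    refine Metric.hausdorffEDist_iUnion_le.trans (iSup_le fun j => ?_)
    have key : ∀ A B : TopologicalSpace.NonemptyCompacts Plane,
        ∀ x ∈ F α j '' (A : Set Plane), ∃ y ∈ F α j '' (B : Set Plane),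
          edist x y ≤ (Real.toNNReal ((1 - α) / 2) : ℝ≥0∞) *
            Metric.hausdorffEDist (A : Set Plane) B := by
      rintro A B _ ⟨x, hx, rfl⟩
      obtain ⟨y, hy, hxy⟩ := B.isCompact.exists_infEDist_eq_edist B.nonempty x
      refine ⟨F α j y, ⟨y, hy, rfl⟩, (hF j x y).trans ?_⟩
      gcongr
      rw [← hxy]
      exact Metric.infEDist_le_hausdorffEDist_of_mem hx
    refine Metric.hausdorffEDist_le_of_mem_edist (key K L) fun x hx => ?_
    rw [Metric.hausdorffEDist_comm]
    exact key L K x hx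
  have : Nonempty (TopologicalSpace.NonemptyCompacts Plane) := ⟨{0}⟩
  let K₀ := hΦ.fixedPoint Φ
  have hK₀ : Φ K₀ = K₀ := hΦ.fixedPoint_isFixedPt
  refine ⟨K₀, ⟨K₀.nonempty, K₀.isCompact, ?_⟩, ?_⟩
  · exact (congrArg (fun K : TopologicalSpace.NonemptyCompacts Plane => (K : Set Plane)) hK₀).symm
  · rintro L ⟨hne, hcomp, hL⟩
    let L' : TopologicalSpace.NonemptyCompacts Plane := ⟨⟨L, hcomp⟩, hne⟩
    have hfix : Function.IsFixedPt Φ L' := TopologicalSpace.NonemptyCompacts.ext hL.symm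
    have := hΦ.fixedPoint_unique hfix
    exact congrArg (fun K : TopologicalSpace.NonemptyCompacts Plane => (K : Set Plane)) this

/-- The range of the parameter `α`. -/
abbrev Param : Type := Set.Ioo (0 : ℝ) (1 / 3)

/-- The stretched Sierpinski gasket `K_α`: the unique non-empty compact set with
`K_α = F_1(K_α) ∪ ⋯ ∪ F_6(K_α)`. -/
def gasket (α : Param) : Set Plane := (existsUnique_gasket α.2.1 α.2.2).choose

theorem gasket_spec (α : Param) :
    (gasket α).Nonempty ∧ IsCompact (gasket α) ∧ gasket α = ⋃ j, F α j '' gasket α :=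
  (existsUnique_gasket α.2.1 α.2.2).choose_spec.1

instance instCompactSpaceGasket (α : Param) : CompactSpace (gasket α) :=
  isCompact_iff_compactSpace.1 (gasket_spec α).2.1

/-- The edges of the graph approximations, each listed once: for every word `w`, the three sides of
the triangle with vertices `F_w(p_1), F_w(p_2), F_w(p_3)`, and the images under `F_w` of the three
initial joining edges. -/
inductive Edge : Type
  | triangle (w : List (Fin 3)) (i : Fin 3) : Edge
  | joining (w : List (Fin 3)) (i : Fin 3) : Edge

/-- The initial point of an edge. -/
def Edge.start (α : ℝ) : Edge → Plane
  | .triangle w i => wordMap α w (vertex (i + 1))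
  | .joining w i => wordMap α w (joinMap α i (vertex (i + 1)))

/-- The end point of an edge. -/
def Edge.finish (α : ℝ) : Edge → Plane
  | .triangle w i => wordMap α w (vertex (i + 2))
  | .joining w i => wordMap α w (joinMap α i (vertex (i + 2)))

/-- The length of an edge. -/
def Edge.length (α : ℝ) (e : Edge) : ℝ := dist (e.start α) (e.finish α)

theorem vertex_ne (i : Fin 3) : vertex (i + 1) ≠ vertex (i + 2) := by
  have h01 : vertex 0 0 = 0 := rfl
  have h11 : vertex 1 0 = 1 / 2 := rfl
  have h21 : vertex 2 0 = 1 := rfl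
  intro h
  have h0 := congrArg (fun v : Plane => v 0) h
  fin_cases i
  · exact absurd (h11.symm.trans (h0.trans h21)) (by norm_num)
  · exact absurd (h21.symm.trans (h0.trans h01)) (by norm_num)
  · exact absurd (h01.symm.trans (h0.trans h11)) (by norm_num)

theorem cornerMap_sub (α : ℝ) (i : Fin 3) (x y : Plane) :
    cornerMap α i x - cornerMap α i y = ((1 - α) / 2) • (x - y) := by
  rw [cornerMap, F_sub]
  ext k
  fin_cases i <;> fin_cases k <;>
    simp [linPart, Matrix.mulVec, dotProduct, Fin.sum_univ_two, Fin.castAdd, Fin.castLE] <;>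
    ring

theorem cornerMap_vertex (α : ℝ) (i : Fin 3) : cornerMap α i (vertex i) = vertex i := by
  fin_cases i <;> simp [cornerMap, F, center, Fin.castAdd, Fin.castLE]

theorem joinMap_side (α : ℝ) (i : Fin 3) (s : ℝ) :
    joinMap α i (vertex (i + 1) + s • (vertex (i + 2) - vertex (i + 1))) =
      vertex (i + 1) + (1 / 2 + α * (s - 1 / 2)) • (vertex (i + 2) - vertex (i + 1)) := by
  have h3 : √3 * √3 = 3 := Real.mul_self_sqrt (by norm_num)
  ext k
  fin_cases i <;> fin_cases k <;>
    simp [joinMap, F, center, linPart, vertex, Fin.natAdd] <;>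
    grind

theorem wordMap_sub (α : ℝ) (w : List (Fin 3)) (x y : Plane) :
    wordMap α w x - wordMap α w y = (((1 - α) / 2) ^ w.length) • (x - y) := by
  induction w with
  | nil => simp [wordMap]
  | cons i w ih =>
    simp only [wordMap, Function.comp_apply, cornerMap_sub, ih, smul_smul, List.length_cons,
      pow_succ']

theorem Edge.length_pos (α : Param) (e : Edge) : 0 < e.length α := by
  obtain ⟨h0, h1⟩ := α.2
  have hc : (0 : ℝ) < (1 - α) / 2 := by linarith
  refine dist_pos.2 fun h => ?_
  rw [← sub_eq_zero] at h
  cases e with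
  | triangle w i =>
    simp only [Edge.start, Edge.finish, wordMap_sub, smul_eq_zero, sub_eq_zero] at h
    exact h.elim (pow_pos hc _).ne' (vertex_ne i)
  | joining w i =>
    simp only [Edge.start, Edge.finish, wordMap_sub, smul_eq_zero, sub_eq_zero] at h
    refine h.elim (pow_pos hc _).ne' fun h => vertex_ne i ?_
    have e0 := joinMap_side α i 0
    have e1 := joinMap_side α i 1
    simp only [zero_smul, add_zero, one_smul, add_sub_cancel] at e0 e1
    rw [e0, e1, add_right_inj, ← sub_eq_zero, ← sub_smul, smul_eq_zero, sub_eq_zero (b := vertex _)]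
      at h
    refine (h.resolve_left fun h' => h0.ne' ?_).symm
    linarith

instance instFactLengthPos (α : Param) (e : Edge) : Fact (0 < e.length α) := ⟨e.length_pos α⟩

/-- The sides of the triangle are contained in the gasket. -/
theorem side_mem_gasket (α : Param) (i : Fin 3) (s : ℝ) (hs : s ∈ Set.Icc (0 : ℝ) 1) :
    vertex (i + 1) + s • (vertex (i + 2) - vertex (i + 1)) ∈ gasket α := by
  obtain ⟨hne, hcomp, hself⟩ := gasket_spec α
  obtain ⟨h0, h1⟩ := α.2
  set c : ℝ := (1 - α) / 2 with hc
  have hc0 : 0 < c := by rw [hc]; linarith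
  have hc1 : c < 1 := by rw [hc]; linarith
  set u := vertex (i + 1)
  set v := vertex (i + 2)
  let p : ℝ → Plane := fun s => u + s • (v - u)
  have hinf : ∀ (j : Fin 6) (x : Plane),
      Metric.infDist (F α j x) (gasket α) ≤ c * Metric.infDist x (gasket α) := by
    intro j x
    obtain ⟨y, hy, hxy⟩ := hcomp.exists_infDist_eq_dist hne x
    have hmem : F α j y ∈ gasket α := by
      rw [hself]
      exact Set.mem_iUnion.2 ⟨j, y, hy, rfl⟩
    refine (Metric.infDist_le_dist_of_mem hmem).trans ?_
    rw [hxy]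
    have h := (lipschitzWith_F h0 h1 j).dist_le_mul x y
    rwa [Real.coe_toNNReal _ hc0.le] at h
  have hstep : ∀ s ∈ Set.Icc (0 : ℝ) 1, ∃ t ∈ Set.Icc (0 : ℝ) 1, ∃ j, p s = F α j (p t) := by
    intro s hs
    have corner : ∀ k x, cornerMap α k x = vertex k + c • (x - vertex k) := by
      intro k x
      have h := cornerMap_sub α k x (vertex k)
      rw [cornerMap_vertex, sub_eq_iff_eq_add] at h
      rw [h, add_comm]
    rcases le_total s c with h | h
    · refine ⟨s / c, ⟨div_nonneg hs.1 hc0.le, (div_le_one hc0).2 h⟩, Fin.castAdd 3 (i + 1), ?_⟩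
      refine Eq.trans ?_ (corner (i + 1) _).symm
      simp only [p, u, add_sub_cancel_left, smul_smul, mul_div_cancel₀ _ hc0.ne']
    rcases le_total (1 - c) s with h' | h'
    · refine ⟨1 - (1 - s) / c, ⟨sub_nonneg.2 ((div_le_one hc0).2 (by linarith)),
        sub_le_self _ (div_nonneg (by linarith [hs.2]) hc0.le)⟩, Fin.castAdd 3 (i + 2), ?_⟩
      refine Eq.trans ?_ (corner (i + 2) _).symm
      have : c * (1 - s) / c = 1 - s := by field_simp
      simp only [p]
      change u + s • (v - u) = v + c • (u + (1 - (1 - s) / c) • (v - u) - v)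
      have e1 : u + (1 - (1 - s) / c) • (v - u) - v = (-((1 - s) / c)) • (v - u) := by module
      rw [e1, smul_smul, mul_neg, mul_div_cancel₀ _ hc0.ne']
      module
    · refine ⟨1 / 2 + (s - 1 / 2) / α, ⟨?_, ?_⟩, Fin.natAdd 3 i, ?_⟩
      · have : -(1 / 2) ≤ (s - 1 / 2) / (α : ℝ) := by rw [le_div_iff₀ h0]; linarith
        linarith
      · have : (s - 1 / 2) / (α : ℝ) ≤ 1 / 2 := by rw [div_le_iff₀ h0]; linarith
        linarith
      · refine Eq.trans ?_ (joinMap_side α i _).symm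
        have : (1 / 2 : ℝ) + α * (1 / 2 + (s - 1 / 2) / α - 1 / 2) = s := by
          field_simp
          ring
        rw [this]
  obtain ⟨M, hM⟩ : ∃ M, ∀ s ∈ Set.Icc (0 : ℝ) 1, Metric.infDist (p s) (gasket α) ≤ M := by
    have hcont : ContinuousOn (fun s => Metric.infDist (p s) (gasket α)) (Set.Icc (0 : ℝ) 1) :=
      ((Metric.continuous_infDist_pt _).comp (by fun_prop)).continuousOn
    obtain ⟨M, hM⟩ := isCompact_Icc.bddAbove_image hcont
    exact ⟨M, fun s hs => hM ⟨s, hs, rfl⟩⟩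
  have hiter : ∀ n : ℕ, ∀ s ∈ Set.Icc (0 : ℝ) 1,
      Metric.infDist (p s) (gasket α) ≤ c ^ n * M := by
    intro n
    induction n with
    | zero => simpa using hM
    | succ n ih =>
      intro s hs
      obtain ⟨t, ht, j, hj⟩ := hstep s hs
      rw [hj, pow_succ', mul_assoc]
      exact (hinf j _).trans (mul_le_mul_of_nonneg_left (ih t ht) hc0.le)
  have hzero : Metric.infDist (p s) (gasket α) ≤ 0 := by
    have hlim := (tendsto_pow_atTop_nhds_zero_of_lt_one hc0.le hc1).mul_const M
    rw [zero_mul] at hlim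
    exact ge_of_tendsto' hlim fun n => hiter n s hs
  exact (hcomp.isClosed.mem_iff_infDist_zero hne).2 (le_antisymm hzero Metric.infDist_nonneg)

theorem F_mem_gasket (α : Param) (j : Fin 6) {x : Plane} (hx : x ∈ gasket α) :
    F α j x ∈ gasket α := by
  rw [(gasket_spec α).2.2]
  exact Set.mem_iUnion.2 ⟨j, x, hx, rfl⟩

theorem wordMap_mem_gasket (α : Param) (w : List (Fin 3)) {x : Plane} (hx : x ∈ gasket α) :
    wordMap α w x ∈ gasket α := by
  induction w with
  | nil => exact hx
  | cons i w ih => exact F_mem_gasket α _ ih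

theorem wordMap_affine (α : ℝ) (w : List (Fin 3)) (x y : Plane) (s : ℝ) :
    wordMap α w x + s • (wordMap α w y - wordMap α w x) = wordMap α w (x + s • (y - x)) := by
  have h := wordMap_sub α w (x + s • (y - x)) x
  rw [sub_eq_iff_eq_add] at h
  rw [h, wordMap_sub, add_sub_cancel_left, smul_comm, add_comm]

theorem edge_mem_gasket (α : Param) (e : Edge) (s : ℝ) (hs : s ∈ Set.Icc (0 : ℝ) 1) :
    e.start α + s • (e.finish α - e.start α) ∈ gasket α := by
  cases e with
  | triangle w i =>
    simp only [Edge.start, Edge.finish, wordMap_affine]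
    exact wordMap_mem_gasket α w (side_mem_gasket α i s hs)
  | joining w i =>
    simp only [Edge.start, Edge.finish, wordMap_affine]
    refine wordMap_mem_gasket α w ?_
    have e0 := joinMap_side α i 0
    have e1 := joinMap_side α i 1
    have es := joinMap_side α i s
    simp only [zero_smul, add_zero, one_smul, add_sub_cancel] at e0 e1
    have : joinMap α i (vertex (i + 1)) +
        s • (joinMap α i (vertex (i + 2)) - joinMap α i (vertex (i + 1))) =
        joinMap α i (vertex (i + 1) + s • (vertex (i + 2) - vertex (i + 1))) := by
      rw [e0, e1, es]
      module
    rw [this]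
    exact F_mem_gasket α _ (side_mem_gasket α i s hs)

theorem edgeCurve_mem (α : Param) (e : Edge) (t : ℝ) (ht : t ∈ Set.Icc 0 (e.length α)) :
    (1 / e.length α) • (t • e.finish α + (e.length α - t) • e.start α) ∈ gasket α := by
  have hl := e.length_pos α
  have h := edge_mem_gasket α e (t / e.length α)
    ⟨div_nonneg ht.1 hl.le, (div_le_one hl).2 ht.2⟩
  convert h using 1
  generalize e.length α = l at hl
  rw [smul_add, smul_smul, smul_smul, mul_sub, one_div_mul_cancel hl.ne', one_div_mul_eq_div]
  module

/-- The parametrization `t ↦ (t ε⁺ + (L(ε) - t) ε⁻) / L(ε)` of the edge `ε` by arc length. -/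
def edgeCurve (α : Param) (e : Edge) : C(Set.Icc (0 : ℝ) (e.length α), gasket α) where
  toFun t := ⟨(1 / e.length α) • ((t : ℝ) • e.finish α + (e.length α - t) • e.start α),
    edgeCurve_mem α e t t.2⟩
  continuous_toFun := by fun_prop

/-- The Hilbert space `H_α`: the direct sum of the Hilbert spaces of the spectral triples of the
edges. -/
abbrev HilbertSpace (α : Param) : Type := SpectralTriple.CurveSumSpace (Edge.length (α : ℝ))

/-- The operator `D_α` of the spectral triple of the gasket: the direct sum of the operators of
the spectral triples of the edges. -/
def dirac (α : Param) : HilbertSpace α →ₗ.[ℂ] HilbertSpace α :=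
  SpectralTriple.curveSumDirac (Edge.length (α : ℝ))

/-- The representation `π_α` of `C(K_α)`: the direct sum of the representations of the spectral
triples of the edges. -/
def rep (α : Param) (f : C(gasket α, ℂ)) : HilbertSpace α →L[ℂ] HilbertSpace α :=
  SpectralTriple.curveSumRep (edgeCurve α) f

/-- The spectral distance on `K_α` of the direct sum spectral triple. -/
def spectralDist (α : Param) (x y : gasket α) : ℝ≥0∞ :=
  SpectralTriple.spectralDist (rep α) (dirac α) x y

end StretchedGasket

end

/-! Conjugating multiplication by `g` on the circle `ℝ / 2ℓℤ` with `e^{itD}` translates `g` by `t`,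
and `‖[D, A]‖ ≤ c` is equivalent to `‖e^{itD} A e^{-itD} - A‖ ≤ c |t|` for all `t`. As the norm of a
multiplication operator is the sup norm, `‖[D, g]‖ ≤ 1` says that `g` is 1-Lipschitz; unfolding `x ↦
|x|` and testing one summand at a time, `‖[D_α, π_α(f)]‖ ≤ 1` says that the continuous function `f`
is 1-Lipschitz along every edge (`commutatorNormLE_rep_iff`). What remains is metric geometry.

Geodesic ≤ spectral: the intrinsic distance to `y` (`reachTime`) is admissible. It is 1-Lipschitz
along edges because they are segments inside the gasket, and it is continuous for the Euclidean
topology because, by self-similarity, a cell of level `n` has intrinsic diameter at most `4 ((1 - α)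
/ 2) ^ n`.

Spectral ≤ geodesic: a path need not be made of edges, so an edgewise bound does not control `f`
along it directly. Instead `f` is replaced by `g` (`exists_locallyNonexpandingOn_near`): keep `f` on
the joining edges that connect cells of level at most `n`, and on each cell of level `n` extend its
three vertex values to a Euclidean 1-Lipschitz function. This is possible because the sides of cells
are edges; the pieces fit together because cells of one level are disjoint and meet these joining
edges only in vertices. The result satisfies `|g z - g x| ≤ d(z, x)` for `z` near `x`. Only the
centre `x` is compared with its neighbours, so this property can be checked on finitely many closed
pieces separately, and it still bounds the variation of `g` along a path by the length. As `n → ∞`,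
`g` tends uniformly to `f`.

Axiom 2: all endpoints of edges lie in the union of the three corner cells, a closed proper subset
of the gasket. A dense set meets its complement, and no concatenation of edges can leave a point
there. -/

noncomputable section

namespace SpectralTriple

/-! ### Commutators with a diagonal operator and the flow `e^{itD}`. -/

section DiagonalCommutator

variable {H : Type*} [NormedAddCommGroup H] [InnerProductSpace ℂ H] {κ : Type*}
  (b : HilbertBasis κ ℂ H) (ev : κ → ℝ)

theorem inner_diagonalOp (h : (diagonalOp b ev).domain) (k : κ) :
    inner ℂ (b k) (diagonalOp b ev h) = ev k * inner ℂ (b k) (h : H) := by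
  rw [← b.repr_apply_apply, ← b.repr_apply_apply]
  change b.repr (b.repr.symm _) k = _
  rw [LinearIsometryEquiv.apply_symm_apply]

theorem mem_diagonalOp_domain_iff (h : H) :
    h ∈ (diagonalOp b ev).domain ↔ Memℓp (fun k => (ev k : ℂ) * inner ℂ (b k) h) 2 := by
  simp only [← b.repr_apply_apply]
  rfl

theorem ext_inner_hilbertBasis {x y : H} (h : ∀ k, inner ℂ (b k) x = inner ℂ (b k) y) : x = y := by
  refine b.repr.injective ?_
  ext k
  simpa only [b.repr_apply_apply] using h k

theorem finsetSum_mem_diagonalOp_domain (s : Finset κ) (a : κ → ℂ) :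
    ∑ j ∈ s, a j • b j ∈ (diagonalOp b ev).domain := by
  classical
  refine Submodule.sum_mem _ fun j _ => Submodule.smul_mem _ _ ?_
  rw [mem_diagonalOp_domain_iff]
  have h := (lp.single 2 j (ev j : ℂ) : lp (fun _ : κ => ℂ) 2).2
  refine cast (congrArg (fun f => Memℓp f 2) ?_) h
  funext k
  rw [orthonormal_iff_ite.1 b.orthonormal k j]
  by_cases hkj : k = j
  · subst hkj; simp
  · simp [hkj]

theorem diagonalOp_finsetSum (s : Finset κ) (a : κ → ℂ) :
    diagonalOp b ev ⟨∑ j ∈ s, a j • b j, finsetSum_mem_diagonalOp_domain b ev s a⟩ =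
      ∑ j ∈ s, (ev j * a j) • b j := by
  classical
  refine ext_inner_hilbertBasis b fun k => ?_
  rw [inner_diagonalOp]
  simp only [inner_sum, inner_smul_right, Finset.mul_sum, orthonormal_iff_ite.1 b.orthonormal]
  refine Finset.sum_congr rfl fun j _ => ?_
  by_cases hkj : k = j
  · subst hkj; simp
  · simp [hkj]

theorem norm_finsetSum_congr (s : Finset κ) {a a' : κ → ℂ} (h : ∀ j, ‖a j‖ = ‖a' j‖) :
    ‖∑ j ∈ s, a j • b j‖ = ‖∑ j ∈ s, a' j • b j‖ := by
  rw [@norm_eq_sqrt_re_inner ℂ, @norm_eq_sqrt_re_inner ℂ H, b.orthonormal.inner_sum,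
    b.orthonormal.inner_sum]
  congr 2
  refine Finset.sum_congr rfl fun j _ => ?_
  rw [RCLike.conj_mul, RCLike.conj_mul, h]

/-- The matrix coefficients of `e^{itD} A e^{-itD} - A`, for the operator `D` with eigenvalues
`ev k` on the Hilbert basis `b`. -/
def IsFlowDifference (A : H →L[ℂ] H) (t : ℝ) (B : H →L[ℂ] H) : Prop :=
  ∀ k j, inner ℂ (b k) (B (b j)) =
    (Complex.exp (Complex.I * ((ev k - ev j) * t : ℝ)) - 1) * inner ℂ (b k) (A (b j))

variable {b ev}

/-- On finite sums `x`, `y` of basis vectors, `r ↦ ⟨y, e^{irD} A e^{-irD} x⟩` is a finite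
exponential sum with derivative `i ⟨e^{-irD} y, [D, A] e^{-irD} x⟩`. The mean value inequality
between `0` and `t` gives the bound, without constructing the unitary group. -/
theorem norm_inner_finsetSum_le {A : H →L[ℂ] H} {c : ℝ}
    (hA : CommutatorNormLE (diagonalOp b ev) A c) {t : ℝ} {B : H →L[ℂ] H}
    (hB : IsFlowDifference b ev A t B) (s : Finset κ) (a a' : κ → ℂ) :
    ‖inner ℂ (∑ k ∈ s, a' k • b k) (B (∑ j ∈ s, a j • b j))‖ ≤
      c * ‖∑ k ∈ s, a' k • b k‖ * ‖∑ j ∈ s, a j • b j‖ * |t| := by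
  let M : κ → κ → ℂ := fun k j => inner ℂ (b k) (A (b j))
  let Φ : ℝ → ℂ := fun r => ∑ k ∈ s, ∑ j ∈ s, starRingEnd ℂ (a' k) * a j * M k j *
    Complex.exp (Complex.I * ((ev k - ev j) * r : ℝ))
  let Φ' : ℝ → ℂ := fun r => ∑ k ∈ s, ∑ j ∈ s, starRingEnd ℂ (a' k) * a j * M k j *
    (Complex.exp (Complex.I * ((ev k - ev j) * r : ℝ)) * (Complex.I * ((ev k - ev j) : ℝ)))
  have hderiv : ∀ r, HasDerivAt Φ (Φ' r) r := by
    intro r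
    refine HasDerivAt.fun_sum fun k _ => HasDerivAt.fun_sum fun j _ => HasDerivAt.const_mul _ ?_
    have h1 : HasDerivAt (fun r : ℝ => (((ev k - ev j) * r : ℝ) : ℂ)) ((ev k - ev j : ℝ) : ℂ) r := by
      simpa using ((hasDerivAt_id r).const_mul (ev k - ev j)).ofReal_comp
    exact (h1.const_mul Complex.I).cexp
  have hbound : ∀ r, ‖Φ' r‖ ≤ c * ‖∑ k ∈ s, a' k • b k‖ * ‖∑ j ∈ s, a j • b j‖ := by
    intro r
    -- The eigenvalues of `e^{-irD}`; being unimodular, they leave the norms of finite sums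
    -- unchanged.
    let u : κ → ℂ := fun j => Complex.exp (Complex.I * (-(ev j * r) : ℝ))
    have hu : ∀ j, ‖u j‖ = 1 := fun j => by
      simp only [u, mul_comm Complex.I]; exact Complex.norm_exp_ofReal_mul_I _
    let x := ∑ j ∈ s, (u j * a j) • b j
    let y := ∑ j ∈ s, (u j * a' j) • b j
    have hx : ‖x‖ = ‖∑ j ∈ s, a j • b j‖ := norm_finsetSum_congr b s fun j => by simp [hu]
    have hy : ‖y‖ = ‖∑ j ∈ s, a' j • b j‖ := norm_finsetSum_congr b s fun j => by simp [hu]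
    obtain ⟨hAx, hle⟩ := hA ⟨x, finsetSum_mem_diagonalOp_domain b ev s _⟩
    have key : Φ' r = Complex.I * inner ℂ y (diagonalOp b ev ⟨A x, hAx⟩ -
        A (diagonalOp b ev ⟨x, finsetSum_mem_diagonalOp_domain b ev s _⟩)) := by
      rw [diagonalOp_finsetSum]
      rw [sum_inner, Finset.mul_sum]
      refine Finset.sum_congr rfl fun k _ => ?_
      rw [inner_smul_left, inner_sub_right, inner_diagonalOp]
      simp only [x, map_sum, map_smul, inner_sum, inner_smul_right, Finset.mul_sum]
      rw [← Finset.sum_sub_distrib, Finset.mul_sum, Finset.mul_sum]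
      refine Finset.sum_congr rfl fun j _ => ?_
      have he : Complex.exp (Complex.I * ((ev k - ev j) * r : ℝ)) = starRingEnd ℂ (u k) * u j := by
        simp only [u]
        rw [← Complex.exp_conj, ← Complex.exp_add]
        congr 1
        simp only [map_mul, Complex.conj_I, Complex.conj_ofReal]
        push_cast
        ring
      rw [he]
      simp only [map_mul, M]
      push_cast
      ring
    rw [key, norm_mul, Complex.norm_I, one_mul]
    refine (norm_inner_le_norm _ _).trans ?_
    rw [hy]
    refine (mul_le_mul_of_nonneg_left hle (norm_nonneg _)).trans (le_of_eq ?_)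
    change _ * (c * ‖x‖) = _
    rw [hx]
    ring
  have hmv := convex_univ.norm_image_sub_le_of_norm_hasDerivWithin_le (f := Φ) (f' := Φ')
    (fun r _ => (hderiv r).hasDerivWithinAt) (fun r _ => hbound r) (Set.mem_univ (0 : ℝ))
    (Set.mem_univ t)
  have hval : inner ℂ (∑ k ∈ s, a' k • b k) (B (∑ j ∈ s, a j • b j)) = Φ t - Φ 0 := by
    rw [sum_inner, ← Finset.sum_sub_distrib]
    refine Finset.sum_congr rfl fun k _ => ?_
    simp only [map_sum, map_smul, inner_sum, inner_smul_left, inner_smul_right, hB _ _]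
    rw [← Finset.sum_sub_distrib]
    refine Finset.sum_congr rfl fun j _ => ?_
    simp [M]
    ring
  rw [hval]
  simpa using hmv

/-- If `‖[D, A]‖ ≤ c`, then `‖e^{itD} A e^{-itD} - A‖ ≤ c |t|`. -/
theorem CommutatorNormLE.norm_le_of_isFlowDifference {A : H →L[ℂ] H} {c : ℝ} (hc : 0 ≤ c)
    (hA : CommutatorNormLE (diagonalOp b ev) A c) {t : ℝ} {B : H →L[ℂ] H}
    (hB : IsFlowDifference b ev A t B) : ‖B‖ ≤ c * |t| := by
  have hweak : ∀ x y : H, ‖inner ℂ y (B x)‖ ≤ c * ‖y‖ * ‖x‖ * |t| := by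
    intro x y
    have hx := b.hasSum_repr x
    have hy := b.hasSum_repr y
    have hBx := (B.continuous.tendsto x).comp hx
    exact le_of_tendsto_of_tendsto (Filter.Tendsto.inner hy hBx).norm
      (((hy.norm.const_mul c).mul hx.norm).mul_const |t|)
      (Filter.Eventually.of_forall fun s => norm_inner_finsetSum_le hA hB s _ _)
  refine B.opNorm_le_bound (by positivity) fun x => ?_
  have h := hweak x (B x)
  rw [inner_self_eq_norm_sq_to_K] at h
  rcases (norm_nonneg (B x)).eq_or_lt with h0 | h0
  · rw [← h0]; positivity
  · refine le_of_mul_le_mul_left ?_ h0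
    simp at h
    nlinarith

/-- If `‖e^{itD} A e^{-itD} - A‖ ≤ c |t|` for all `t`, then `‖[D, A]‖ ≤ c`. -/
theorem commutatorNormLE_of_isFlowDifference {A : H →L[ℂ] H} {c : ℝ} (hc : 0 ≤ c)
    {B : ℝ → H →L[ℂ] H} (hB : ∀ t, IsFlowDifference b ev A t (B t)) (hBn : ∀ t, ‖B t‖ ≤ c * |t|) :
    CommutatorNormLE (diagonalOp b ev) A c := by
  intro h
  let v : H := diagonalOp b ev h
  -- The coefficients that `[D, A] h` must have. Whether `A h` lies in the domain is still open; it
  -- will follow from square summability of `r`.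
  let r : κ → ℂ := fun k => ev k * inner ℂ (b k) (A h) - inner ℂ (b k) (A v)
  have hlim : ∀ k, Filter.Tendsto (fun t : ℝ => (t : ℂ)⁻¹ * inner ℂ (b k) (B t h))
      (nhdsWithin 0 {0}ᶜ) (nhds (Complex.I * r k)) := by
    intro k
    have expand : ∀ (T : H →L[ℂ] H) (z : H),
        HasSum (fun j => inner ℂ (b j) z * inner ℂ (b k) (T (b j))) (inner ℂ (b k) (T z)) := by
      intro T z
      have h1 := ((innerSL ℂ (b k)).comp T).hasSum (b.hasSum_repr z)
      simpa [b.repr_apply_apply, inner_smul_right] using h1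
    have e1 := expand A h
    have e2 := expand A v
    -- The series converges because `h ∈ Dom D`: the terms with `ev j` are those of the expansion of
    -- `A (D h)`.
    have e3 : HasSum (fun j => Complex.I * ((ev k - ev j : ℝ) : ℂ) *
        (inner ℂ (b j) (h : H) * inner ℂ (b k) (A (b j)))) (Complex.I * r k) := by
      have := ((e1.mul_left (ev k : ℂ)).sub e2).mul_left Complex.I
      refine this.congr_fun fun j => ?_
      simp only [v, inner_diagonalOp]
      push_cast
      ring
    -- Scalar summability is absolute, so this series dominates the difference quotients, by
    -- `|e^{iθ} - 1| ≤ |θ|`.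
    have hsum : Summable fun j => ‖Complex.I * ((ev k - ev j : ℝ) : ℂ) *
        (inner ℂ (b j) (h : H) * inner ℂ (b k) (A (b j)))‖ := e3.summable.norm
    rw [← e3.tsum_eq]
    have heq : ∀ t : ℝ, (t : ℂ)⁻¹ * inner ℂ (b k) (B t h) =
        ∑' j, ((t : ℂ)⁻¹ * (Complex.exp (Complex.I * ((ev k - ev j) * t : ℝ)) - 1)) *
          (inner ℂ (b j) (h : H) * inner ℂ (b k) (A (b j))) := by
      intro t
      rw [← ((expand (B t) h).mul_left (t : ℂ)⁻¹).tsum_eq]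
      refine tsum_congr fun j => ?_
      rw [hB t k j]
      ring
    simp only [heq]
    refine tendsto_tsum_of_dominated_convergence hsum (fun j => ?_)
      (Filter.Eventually.of_forall fun t j => ?_)
    · refine Filter.Tendsto.mul_const _ ?_
      have h1 : HasDerivAt (fun t : ℝ => Complex.exp (Complex.I * ((ev k - ev j) * t : ℝ)))
          (Complex.I * ((ev k - ev j : ℝ) : ℂ)) 0 := by
        have h1 : HasDerivAt (fun t : ℝ => (((ev k - ev j) * t : ℝ) : ℂ))
            ((ev k - ev j : ℝ) : ℂ) 0 := by
          simpa using ((hasDerivAt_id (0 : ℝ)).const_mul (ev k - ev j)).ofReal_comp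
        simpa using (h1.const_mul Complex.I).cexp
      have h2 := hasDerivAt_iff_tendsto_slope_zero.1 h1
      refine h2.congr fun t => ?_
      simp
    · rw [norm_mul, norm_mul _ (inner ℂ (b j) (h : H) * _)]
      gcongr
      rw [norm_mul, norm_inv, norm_mul, Complex.norm_I, one_mul, Complex.norm_real, Complex.norm_real]
      rcases eq_or_ne t 0 with rfl | ht
      · simp
      · rw [inv_mul_le_iff₀ (norm_pos_iff.2 ht)]
        refine (Real.norm_exp_I_mul_ofReal_sub_one_le).trans ?_
        rw [norm_mul, mul_comm]
  -- Bessel's inequality for `t⁻¹ B t h`, followed by `t → 0` in finitely many coordinates.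
  have hfin : ∀ s : Finset κ, ∑ k ∈ s, ‖r k‖ ^ 2 ≤ (c * ‖(h : H)‖) ^ 2 := by
    intro s
    have hl : Filter.Tendsto (fun t : ℝ => ∑ k ∈ s, ‖(t : ℂ)⁻¹ * inner ℂ (b k) (B t h)‖ ^ 2)
        (nhdsWithin 0 {0}ᶜ) (nhds (∑ k ∈ s, ‖Complex.I * r k‖ ^ 2)) :=
      tendsto_finsetSum _ fun k _ => ((hlim k).norm.pow 2)
    simp only [norm_mul Complex.I, Complex.norm_I, one_mul] at hl
    refine le_of_tendsto hl ?_
    filter_upwards [self_mem_nhdsWithin] with t ht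
    have ht' : 0 < |t| := abs_pos.2 ht
    simp only [norm_mul, mul_pow, ← Finset.mul_sum, norm_inv, Complex.norm_real, Real.norm_eq_abs]
    refine (mul_le_mul_of_nonneg_left (b.orthonormal.sum_inner_products_le (B t h))
      (by positivity)).trans ?_
    have hn : ‖B t h‖ ≤ c * |t| * ‖(h : H)‖ :=
      ((B t).le_opNorm _).trans (mul_le_mul_of_nonneg_right (hBn t) (norm_nonneg _))
    rw [inv_pow, inv_mul_le_iff₀ (by positivity)]
    refine (pow_le_pow_left₀ (norm_nonneg _) hn 2).trans (le_of_eq (by ring))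
  have hr : Memℓp r 2 := memℓp_gen' (C := (c * ‖(h : H)‖) ^ 2) fun s => by
    simpa using hfin s
  have hmem : A h ∈ (diagonalOp b ev).domain := by
    rw [mem_diagonalOp_domain_iff]
    have h2 : Memℓp (fun k => inner ℂ (b k) (A v)) 2 := by
      simp only [← b.repr_apply_apply]
      exact (b.repr (A v)).2
    refine cast (congrArg (fun f => Memℓp f 2) ?_) (hr.add h2)
    funext k
    simp [r]
  refine ⟨hmem, ?_⟩
  rw [← b.repr.norm_map]
  refine lp.norm_le_of_forall_sum_le (by simp) (by positivity) fun s => ?_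
  simp only [ENNReal.toReal_ofNat, Real.rpow_ofNat, b.repr_apply_apply, inner_sub_right,
    inner_diagonalOp]
  exact hfin s

end DiagonalCommutator

/-! ### Multiplication operators on the circle. -/

section Circle

open MeasureTheory AddCircle

variable {X : Type*} [TopologicalSpace X] {ℓ : ℝ} [hℓ : Fact (0 < ℓ)]

theorem inner_fourierBasis_mulOp (g : C(AddCircle (2 * ℓ), ℂ)) (k j : ℤ) :
    inner ℂ (fourierBasis (T := 2 * ℓ) k) (mulOp g (fourierBasis (T := 2 * ℓ) j)) =
      fourierCoeff g (k - j) := by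
  rw [L2.inner_def, fourierCoeff]
  refine integral_congr_ae ?_
  rw [coe_fourierBasis]
  filter_upwards [mulOp_apply_ae g (fourierLp (T := 2 * ℓ) 2 j), coeFn_fourierLp (T := 2 * ℓ) 2 k,
    coeFn_fourierLp (T := 2 * ℓ) 2 j] with x h1 h2 h3
  rw [h1, h2, h3, RCLike.inner_apply, neg_sub, sub_eq_add_neg, fourier_add, fourier_neg, smul_eq_mul]
  ring

theorem fourierCoeff_comp_addRight (g : C(AddCircle (2 * ℓ), ℂ)) (t : AddCircle (2 * ℓ)) (n : ℤ) :
    fourierCoeff (g.comp (ContinuousMap.addRight t)) n = fourier n t * fourierCoeff g n := by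
  have h := integral_add_right_eq_self (μ := haarAddCircle (T := 2 * ℓ))
    (fun x => fourier (-n) x • g x) t
  rw [fourierCoeff, fourierCoeff, ← h, ← integral_const_mul]
  refine integral_congr_ae (Filter.Eventually.of_forall fun x => ?_)
  have e : fourier n t * fourier (-n) (x + t) = fourier (-n) x := by
    rw [fourier_apply, fourier_apply, fourier_apply, ← Circle.coe_mul, ← toCircle_add, smul_add,
      neg_smul, neg_smul, add_comm, add_assoc, neg_add_cancel, add_zero]
  simp only [smul_eq_mul]
  rw [← mul_assoc, e]
  rfl

/-- Translation by `t` multiplies the Fourier coefficient at `k - j` by `e^{iπ(k-j)t/ℓ}`, which is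
the factor produced by the flow. The shift `π/(2ℓ)` cancels in the difference of two eigenvalues. -/
theorem isFlowDifference_mulOp (g : C(AddCircle (2 * ℓ), ℂ)) (t : ℝ) :
    IsFlowDifference (fourierBasis (T := 2 * ℓ))
      (fun k : ℤ => (2 * (k : ℝ) + 1) * Real.pi / (2 * ℓ)) (mulOp g) t
      (mulOp (g.comp (ContinuousMap.addRight (t : AddCircle (2 * ℓ))) - g)) := by
  intro k j
  have hℓ0 : (ℓ : ℂ) ≠ 0 := Complex.ofReal_ne_zero.2 hℓ.out.ne'
  rw [inner_fourierBasis_mulOp, inner_fourierBasis_mulOp, sub_mul, one_mul]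
  have e : fourierCoeff (g.comp (ContinuousMap.addRight (t : AddCircle (2 * ℓ))) - g) (k - j) =
      fourierCoeff (g.comp (ContinuousMap.addRight (t : AddCircle (2 * ℓ)))) (k - j) -
        fourierCoeff g (k - j) := by
    simp only [fourierCoeff]
    rw [← integral_sub]
    · refine integral_congr_ae (Filter.Eventually.of_forall fun x => ?_)
      simp [mul_sub]
    · exact (Continuous.integrable_of_hasCompactSupport (by fun_prop)
        (HasCompactSupport.of_compactSpace _))
    · exact (Continuous.integrable_of_hasCompactSupport (by fun_prop)
        (HasCompactSupport.of_compactSpace _))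
  rw [e, fourierCoeff_comp_addRight, fourier_coe_apply]
  congr 3
  push_cast
  field_simp
  ring

/-- If `|g x|` exceeded the operator norm, then so would `|g|` on a nonempty open set, which has
positive Haar measure; its indicator contradicts the norm bound. -/
theorem norm_apply_le_norm_mulOp (g : C(AddCircle (2 * ℓ), ℂ)) (x : AddCircle (2 * ℓ)) :
    ‖g x‖ ≤ ‖mulOp g‖ := by
  by_contra! hlt
  obtain ⟨m, hm1, hm2⟩ := exists_between hlt
  have hm0 : 0 < m := (norm_nonneg _).trans_lt hm1
  let U : Set (AddCircle (2 * ℓ)) := {y | m < ‖g y‖}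
  have hU : IsOpen U := isOpen_lt continuous_const g.continuous.norm
  have hUpos : 0 < haarAddCircle U := hU.measure_pos _ ⟨x, hm2⟩
  let h : CurveSpace ℓ := indicatorConstLp 2 hU.measurableSet (measure_ne_top _ U) (1 : ℂ)
  have hh : 0 < ‖h‖ := by
    rw [norm_indicatorConstLp (by norm_num) (by norm_num)]
    rw [norm_one, one_mul]
    exact Real.rpow_pos_of_pos (ENNReal.toReal_pos hUpos.ne' (measure_ne_top _ U)) _
  have h1 : m * ‖h‖ ≤ ‖mulOp g h‖ := by
    have : ‖(m : ℂ) • h‖ ≤ ‖mulOp g h‖ := by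
      refine Lp.norm_le_norm_of_ae_le ?_
      filter_upwards [mulOp_apply_ae g h, Lp.coeFn_smul (m : ℂ) h,
        indicatorConstLp_coeFn (p := 2) (hs := hU.measurableSet) (hμs := measure_ne_top haarAddCircle U)
          (c := (1 : ℂ))] with y e1 e2 e3
      rw [e1, e2, Pi.smul_apply, smul_eq_mul, norm_mul, norm_mul, e3]
      by_cases hy : y ∈ U
      · simpa [hy, abs_of_pos hm0] using le_of_lt (show m < ‖g y‖ from hy)
      · simp [hy]
    rwa [norm_smul, Complex.norm_real, Real.norm_of_nonneg hm0.le] at this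
  have h2 := (mulOp g).le_opNorm h
  nlinarith

/-- The commutator of `D_ℓ` with multiplication by `g` is bounded by `1` if and only if `g` is
`1`-Lipschitz. -/
theorem commutatorNormLE_mulOp_iff (g : C(AddCircle (2 * ℓ), ℂ)) :
    CommutatorNormLE (curveDirac ℓ) (mulOp g) 1 ↔ LipschitzWith 1 g := by
  constructor
  · intro h
    refine LipschitzWith.of_dist_le_mul fun x y => ?_
    have key : ∀ (z : AddCircle (2 * ℓ)) (t : ℝ), ‖g (z + t) - g z‖ ≤ |t| := by
      intro z t
      have h1 := h.norm_le_of_isFlowDifference zero_le_one (isFlowDifference_mulOp g t)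
      rw [one_mul] at h1
      exact (norm_apply_le_norm_mulOp (g.comp (ContinuousMap.addRight (t : AddCircle (2 * ℓ))) - g)
        z).trans h1
    -- The representative of `x - y` of least absolute value realizes the quotient norm.
    obtain ⟨t, ht1, ht2⟩ : ∃ t : ℝ, (t : AddCircle (2 * ℓ)) = x - y ∧ |t| ≤ ‖x - y‖ := by
      induction x - y using QuotientAddGroup.induction_on with
      | H r =>
        refine ⟨r - round ((2 * ℓ)⁻¹ * r) * (2 * ℓ), ?_, ?_⟩
        · rw [AddCircle.coe_sub, ← zsmul_eq_mul, AddCircle.coe_zsmul, AddCircle.coe_period, smul_zero,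
            sub_zero]
        · exact le_of_eq (AddCircle.norm_eq (2 * ℓ) (x := r)).symm
    have h2 := key y t
    rw [ht1, add_sub_cancel] at h2
    rw [NNReal.coe_one, one_mul, dist_eq_norm, dist_eq_norm]
    exact h2.trans ht2
  · intro h
    refine commutatorNormLE_of_isFlowDifference zero_le_one (isFlowDifference_mulOp g) fun t => ?_
    rw [one_mul]
    refine (norm_mulOp_le _).trans ((ContinuousMap.norm_le _ (abs_nonneg t)).2 fun x => ?_)
    have h1 := h.dist_le_mul (x + t) x
    rw [NNReal.coe_one, one_mul, dist_eq_norm, dist_eq_norm, add_sub_cancel_left] at h1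
    refine h1.trans ?_
    exact QuotientAddGroup.norm_mk_le_norm

/-- The folding map `x ↦ |x|` from the circle to `[0, ℓ]` and its section `[0, ℓ] → ℝ / 2ℓℤ` are
both 1-Lipschitz, so the Lipschitz condition passes in either direction. -/
theorem commutatorNormLE_curveRep_iff (R : C(Set.Icc (0 : ℝ) ℓ, X)) (f : C(X, ℂ)) :
    CommutatorNormLE (curveDirac ℓ) (curveRep R f) 1 ↔ LipschitzWith 1 (f ∘ R) := by
  rw [curveRep, commutatorNormLE_mulOp_iff]
  constructor
  · intro h
    refine LipschitzWith.of_dist_le_mul fun x y => ?_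
    have hn : ∀ z : Set.Icc (0 : ℝ) ℓ, ‖((z : ℝ) : AddCircle (2 * ℓ))‖ = z := by
      intro z
      have hpos := hℓ.out
      rw [(AddCircle.norm_coe_eq_abs_iff (2 * ℓ) (by positivity)).2, abs_of_nonneg z.2.1]
      rw [abs_of_nonneg z.2.1, abs_of_pos (by positivity)]
      linarith [z.2.2]
    have hf : ∀ z : Set.Icc (0 : ℝ) ℓ, foldedCurve R ((z : ℝ) : AddCircle (2 * ℓ)) = R z := by
      intro z
      exact congrArg R (Subtype.ext (hn z))
    have h1 := h.dist_le_mul ((x : ℝ) : AddCircle (2 * ℓ)) ((y : ℝ) : AddCircle (2 * ℓ))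
    rw [ContinuousMap.comp_apply, ContinuousMap.comp_apply, hf, hf] at h1
    refine h1.trans ?_
    gcongr
    rw [dist_eq_norm, ← AddCircle.coe_sub]
    exact QuotientAddGroup.norm_mk_le_norm
  · intro h
    refine LipschitzWith.of_dist_le_mul fun x y => (h.dist_le_mul _ _).trans ?_
    gcongr
    rw [Subtype.dist_eq, dist_eq_norm x y]
    exact abs_norm_sub_norm_le x y

end Circle

/-! ### Commutators on direct sums. -/

section DirectSumCommutator

variable {ι : Type*} {G : ι → Type*} [∀ i, NormedAddCommGroup (G i)]
  [∀ i, InnerProductSpace ℂ (G i)]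

/-- One direction tests vectors supported in a single summand. In the other, the componentwise
commutators are bounded by `c ‖x i‖` with the same `c`, hence are square summable, which places the
image in the domain. -/
theorem commutatorNormLE_directSumOp_iff (D : ∀ i, G i →ₗ.[ℂ] G i) (A : ∀ i, G i →L[ℂ] G i) {K : ℝ}
    (hK : 0 ≤ K) (hA : ∀ i, ‖A i‖ ≤ K) {c : ℝ} (hc : 0 ≤ c) :
    CommutatorNormLE (directSumOp D) (lp.mapCLM 2 A hK hA) c ↔
      ∀ i, CommutatorNormLE (D i) (A i) c := by
  classical
  -- The argument of `D i` carries a membership proof, which obstructs rewriting; equalities of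
  -- vectors are transported by this instead.
  have hcongr : ∀ (i : ι) {x y : G i} (hx : x ∈ (D i).domain) (hy : y ∈ (D i).domain), x = y →
      D i ⟨x, hx⟩ = D i ⟨y, hy⟩ := by
    rintro i x y hx hy rfl
    rfl
  constructor
  · intro h i x
    have hself : (lp.single 2 i (x : G i) : lp G 2) i = x := lp.single_apply_self _ _ _
    have hdom : (lp.single 2 i (x : G i) : lp G 2) ∈ (directSumOp D).domain := by
      have hd : ∀ j, (lp.single 2 i (x : G i) : lp G 2) j ∈ (D j).domain := by
        intro j
        rcases eq_or_ne j i with rfl | hj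
        · rw [lp.single_apply_self]; exact x.2
        · rw [lp.single_apply_ne _ _ _ hj]; exact (D j).domain.zero_mem
      refine ⟨hd, ?_⟩
      refine cast (congrArg (fun f => Memℓp f 2) ?_) (lp.single 2 i (D i x) : lp G 2).2
      funext j
      rcases eq_or_ne j i with rfl | hj
      · rw [lp.single_apply_self]
        exact hcongr j x.2 (hd j) hself.symm
      · rw [lp.single_apply_ne _ _ _ hj, ← (D j).map_zero]
        exact hcongr j _ (hd j) (lp.single_apply_ne _ _ _ hj).symm
    obtain ⟨hm, hle⟩ := h ⟨_, hdom⟩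
    have hi : A i x ∈ (D i).domain := by
      have : A i ((lp.single 2 i (x : G i) : lp G 2) i) ∈ (D i).domain := hm.1 i
      rwa [hself] at this
    refine ⟨hi, ?_⟩
    have h1 := (lp.norm_apply_le_norm (by norm_num) _ i).trans hle
    rw [lp.norm_single (by norm_num)] at h1
    refine le_trans (le_of_eq ?_) h1
    have e1 : D i ⟨A i x, hi⟩ = D i ⟨A i ((lp.single 2 i (x : G i) : lp G 2) i), hm.1 i⟩ :=
      hcongr i hi (hm.1 i) (congrArg (A i) hself.symm)
    have e2 : D i x = D i ⟨(lp.single 2 i (x : G i) : lp G 2) i, hdom.1 i⟩ :=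
      hcongr i x.2 (hdom.1 i) hself.symm
    rw [e1, e2]
    rfl
  · intro h x
    choose hd hle using fun i => h i ⟨(x : lp G 2) i, x.2.1 i⟩
    let r : ∀ i, G i := fun i => D i ⟨A i ((x : lp G 2) i), hd i⟩ -
      A i (D i ⟨(x : lp G 2) i, x.2.1 i⟩)
    have hr : Memℓp r 2 := ((lp.memℓp (x : lp G 2)).norm.const_mul c |>.mono
      fun i => by simpa [abs_of_nonneg hc] using hle i).of_norm
    have hm : lp.mapCLM 2 A hK hA x ∈ (directSumOp D).domain := by
      refine ⟨hd, ?_⟩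
      refine cast (congrArg (fun f => Memℓp f 2) ?_)
        (hr.add (lp.mapCLM 2 A hK hA (directSumOp D x)).2)
      funext i
      exact sub_add_cancel _ _
    refine ⟨hm, ?_⟩
    have hn : c * ‖(x : lp G 2)‖ = ‖(c : ℂ) • (x : lp G 2)‖ := by
      rw [norm_smul, Complex.norm_real, Real.norm_of_nonneg hc]
    rw [hn]
    refine lp.norm_mono (by norm_num) fun i => ?_
    rw [lp.coeFn_smul, Pi.smul_apply, norm_smul, Complex.norm_real, Real.norm_of_nonneg hc]
    exact hle i

end DirectSumCommutator

section CurveSumCommutator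

variable {X : Type*} [TopologicalSpace X] [CompactSpace X] {ι : Type*} {ℓ : ι → ℝ}
  [∀ i, Fact (0 < ℓ i)]

theorem commutatorNormLE_curveSumRep_iff (R : ∀ i, C(Set.Icc (0 : ℝ) (ℓ i), X)) (f : C(X, ℂ)) :
    CommutatorNormLE (curveSumDirac ℓ) (curveSumRep R f) 1 ↔ ∀ i, LipschitzWith 1 (f ∘ R i) := by
  rw [curveSumDirac, curveSumRep, commutatorNormLE_directSumOp_iff _ _ _ _ zero_le_one]
  exact forall_congr' fun i => commutatorNormLE_curveRep_iff (R i) f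

end CurveSumCommutator

end SpectralTriple

namespace LengthSpace

open Set Filter Topology

/-! ### Locally nonexpanding functions along paths. -/

section Nonexpanding

variable {E : Type*} [PseudoMetricSpace E] {g : E → ℝ} {s : Set E}

/-- Every point `x` of `s` has a neighbourhood in `s` in which `|g y - g x| ≤ d(y, x)`. -/
def LocallyNonexpandingOn (g : E → ℝ) (s : Set E) : Prop :=
  ∀ x ∈ s, ∀ᶠ y in 𝓝[s] x, |g y - g x| ≤ dist y x

theorem LocallyNonexpandingOn.of_lipschitzOnWith (h : LipschitzOnWith 1 g s) :
    LocallyNonexpandingOn g s := by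
  intro x hx
  filter_upwards [self_mem_nhdsWithin] with y hy
  simpa [Real.dist_eq] using h.dist_le_mul y hy x hx

/-- A function which is locally nonexpanding on `s` cannot vary by more than the length of a path
in `s` between the endpoints of the path. -/
theorem LocallyNonexpandingOn.edist_le_pathLength (hg : LocallyNonexpandingOn g s) {x y : s}
    (γ : Path x y) : edist (g x) (g y) ≤ pathLength γ := by
  let P : unitInterval → unitInterval → Prop := fun a b =>
    edist (g (γ a)) (g (γ b)) ≤ eVariationOn γ (Icc a b)
  have hloc : ∀ r : unitInterval, ∀ᶠ r' in 𝓝 r, edist (g (γ r')) (g (γ r)) ≤ edist (γ r') (γ r) := by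
    intro r
    have hγ : Tendsto (fun r' => (γ r' : E)) (𝓝 r) (𝓝[s] (γ r : E)) :=
      tendsto_nhdsWithin_iff.2 ⟨(continuous_subtype_val.comp γ.continuous).continuousAt,
        Eventually.of_forall fun r' => (γ r').2⟩
    filter_upwards [hγ.eventually (hg (γ r) (γ r).2)] with r' hr'
    rw [Subtype.edist_eq, edist_dist, edist_dist, Real.dist_eq]
    exact ENNReal.ofReal_le_ofReal hr'
  have hP : ∀ a b, a ≤ b → edist (g (γ a)) (g (γ b)) ≤ edist (γ a) (γ b) → P a b := by
    intro a b hab h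
    exact h.trans (eVariationOn.edist_le _ (left_mem_Icc.2 hab) (right_mem_Icc.2 hab))
  have htrans : ∀ a b c, a ≤ b → b ≤ c → P a b → P b c → P a c := by
    intro a b c hab hbc h1 h2
    have h := eVariationOn.Icc_add_Icc γ hab hbc (mem_univ b)
    simp only [univ_inter] at h
    exact (edist_triangle _ (g (γ b)) _).trans ((add_le_add h1 h2).trans h.le)
  -- Additivity of the variation makes `P` transitive. Hence `sup S` belongs to `S`, and the local
  -- estimate at `sup S` would extend `S` further if it were below `1`.
  let S : Set unitInterval := {r | P 0 r}
  have h0 : (0 : unitInterval) ∈ S := hP 0 0 le_rfl (by simp)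
  have hS : IsLUB S (sSup S) := isLUB_sSup S
  set m := sSup S
  have hm : m ∈ S := by
    have h1 := (hS.frequently_mem ⟨0, h0⟩).and_eventually
      ((hloc m).filter_mono nhdsWithin_le_nhds)
    obtain ⟨r, ⟨hr, hrm⟩⟩ := h1.exists
    exact htrans 0 r m unitInterval.nonneg' (hS.1 hr) hr (hP r m (hS.1 hr) hrm)
  have hm1 : m = 1 := by
    by_contra hne
    have hlt : m < 1 := lt_of_le_of_ne unitInterval.le_one' hne
    have : (𝓝[>] m).NeBot := nhdsGT_neBot_of_exists_gt ⟨1, hlt⟩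
    have h1 := ((hloc m).filter_mono nhdsWithin_le_nhds).and
      (self_mem_nhdsWithin : Ioi m ∈ 𝓝[>] m)
    obtain ⟨r, hr, hmr⟩ := h1.exists
    rw [edist_comm, edist_comm (γ r)] at hr
    exact not_lt_of_ge
      (hS.1 (htrans 0 m r unitInterval.nonneg' (le_of_lt hmr) hm (hP m r (le_of_lt hmr) hr))) hmr
  rw [hm1] at hm
  have h : edist (g (γ 0)) (g (γ 1)) ≤ eVariationOn γ (Icc 0 1) := hm
  rw [γ.source, γ.target] at h
  exact h.trans (eVariationOn.mono _ (subset_univ _))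

end Nonexpanding

/-! ### Reachability at unit speed and the intrinsic distance. -/

section Reach

variable {E : Type*} [MetricSpace E] {K : Set E} {L L' : ℝ} {x y z : E}

/-- There is a path of unit speed at most in `K` which is at `x` at the time `0` and at `y` at the
time `L`. -/
def Reach (K : Set E) (L : ℝ) (x y : E) : Prop :=
  ∃ g : ℝ → E, LipschitzWith 1 g ∧ (∀ t, g t ∈ K) ∧ g 0 = x ∧ g L = y

theorem Reach.refl (hx : x ∈ K) (L : ℝ) : Reach K L x x :=
  ⟨fun _ => x, LipschitzWith.const' x, fun _ => hx, rfl, rfl⟩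

theorem Reach.symm (h : Reach K L x y) : Reach K L y x := by
  obtain ⟨g, hg, hK, h0, hL⟩ := h
  refine ⟨fun t => g (L - t), LipschitzWith.of_dist_le_mul fun s t => ?_, fun t => hK _, ?_, ?_⟩
  · refine (hg.dist_le_mul _ _).trans (le_of_eq ?_)
    rw [dist_sub_left]
  · simpa using hL
  · simpa using h0

theorem Reach.left_mem (h : Reach K L x y) : x ∈ K := by
  obtain ⟨g, hg, hK, h0, hL⟩ := h
  exact h0 ▸ hK 0

theorem Reach.right_mem (h : Reach K L x y) : y ∈ K := h.symm.left_mem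

theorem Reach.trans (hL : 0 ≤ L) (hL' : 0 ≤ L') (h : Reach K L x y) (h' : Reach K L' y z) :
    Reach K (L + L') x z := by
  obtain ⟨g, hg, hK, h0, h1⟩ := h
  obtain ⟨g', hg', hK', h0', h1'⟩ := h'
  have key : ∀ s t : ℝ, s ≤ t → dist (if s ≤ L then g s else g' (s - L))
      (if t ≤ L then g t else g' (t - L)) ≤ t - s := by
    intro s t hst
    have d1 : ∀ u v, u ≤ v → dist (g u) (g v) ≤ v - u := fun u v huv => by
      simpa [Real.dist_eq, abs_sub_comm u v, abs_of_nonneg (sub_nonneg.2 huv)] using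
        hg.dist_le_mul u v
    have d2 : ∀ u v, u ≤ v → dist (g' u) (g' v) ≤ v - u := fun u v huv => by
      simpa [Real.dist_eq, abs_sub_comm u v, abs_of_nonneg (sub_nonneg.2 huv)] using
        hg'.dist_le_mul u v
    by_cases hs : s ≤ L <;> by_cases ht : t ≤ L
    · simpa [hs, ht] using d1 s t hst
    · push Not at ht
      simp only [hs, ht.not_ge, if_true, if_false]
      have e1 := d1 s L hs
      have e2 := d2 0 (t - L) (by linarith)
      rw [h1] at e1
      rw [h0'] at e2
      linarith [dist_triangle (g s) y (g' (t - L))]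
    · exact absurd (hst.trans ht) hs
    · simp only [hs, ht, if_false]
      linarith [d2 (s - L) (t - L) (by linarith)]
  refine ⟨fun t => if t ≤ L then g t else g' (t - L), LipschitzWith.of_dist_le_mul fun s t => ?_,
    fun t => ?_, ?_, ?_⟩
  · rw [NNReal.coe_one, one_mul, Real.dist_eq]
    rcases le_total s t with hst | hst
    · rw [abs_sub_comm, abs_of_nonneg (sub_nonneg.2 hst)]
      exact key s t hst
    · rw [abs_of_nonneg (sub_nonneg.2 hst), dist_comm]
      exact key t s hst
  · dsimp only
    split_ifs
    exacts [hK _, hK' _]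
  · simp [hL, h0]
  · dsimp only
    split_ifs with h
    -- For `L' = 0` the final time still falls into the first branch.
    · have : L' = 0 := by linarith
      subst this
      rw [add_zero, h1, ← h1', h0']
    · simpa using h1'

theorem Reach.mono (hL : 0 ≤ L) (hLL : L ≤ L') (h : Reach K L x y) : Reach K L' x y := by
  simpa using h.trans hL (sub_nonneg.2 hLL) (Reach.refl h.right_mem _)

theorem Reach.image {E' : Type*} [MetricSpace E'] {K' : Set E'} {f : E → E'} {c : ℝ} (hc : 0 < c)
    (hf : ∀ u v, dist (f u) (f v) ≤ c * dist u v) (hK : MapsTo f K K') (h : Reach K L x y) :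
    Reach K' (c * L) (f x) (f y) := by
  obtain ⟨g, hg, hK', h0, hL⟩ := h
  refine ⟨fun t => f (g (t / c)), LipschitzWith.of_dist_le_mul fun s t => ?_, fun t => hK (hK' _),
    ?_, ?_⟩
  · refine (hf _ _).trans ((mul_le_mul_of_nonneg_left (hg.dist_le_mul _ _) hc.le).trans
      (le_of_eq ?_))
    rw [Real.dist_eq, Real.dist_eq, ← sub_div, abs_div, abs_of_pos hc]
    simp only [NNReal.coe_one]
    field_simp
  · simp [h0]
  · simp [mul_div_cancel_left₀ L hc.ne', hL]

/-- The maps `ℝ → K` form a compact set by Tychonoff, and the speed bound and the initial condition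
are closed under pointwise limits; the set in question is the image under evaluation at `L`. -/
theorem isClosed_setOf_reach (hK : IsCompact K) (L : ℝ) (x : E) : IsClosed {y | Reach K L x y} := by
  let C : Set (ℝ → E) := univ.pi (fun _ => K) ∩ ({g | LipschitzWith 1 g} ∩ {g | g 0 = x})
  have hC : IsCompact C := by
    refine (isCompact_univ_pi fun _ => hK).inter_right (IsClosed.inter ?_ ?_)
    · have : {g : ℝ → E | LipschitzWith 1 g} = ⋂ (s : ℝ) (t : ℝ), {g | dist (g s) (g t) ≤ dist s t} := by
        ext g
        simp [lipschitzWith_iff_dist_le_mul]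
      rw [this]
      exact isClosed_iInter fun s => isClosed_iInter fun t =>
        isClosed_le ((continuous_apply s).dist (continuous_apply t)) continuous_const
    · exact isClosed_eq (continuous_apply 0) continuous_const
  have himg : {y | Reach K L x y} = (fun g : ℝ → E => g L) '' C := by
    ext y
    constructor
    · rintro ⟨g, hg, hK, h0, hL⟩
      exact ⟨g, ⟨fun t _ => hK t, hg, h0⟩, hL⟩
    · rintro ⟨g, ⟨hK, hg, h0⟩, hL⟩
      exact ⟨g, hg, fun t => hK t (mem_univ t), h0, hL⟩
  rw [himg]
  exact (hC.image (continuous_apply L)).isClosed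

theorem Reach.geodesicDist_le {x y : K} (hL : 0 ≤ L) (h : Reach K L (x : E) y) :
    geodesicDist x y ≤ ENNReal.ofReal L := by
  obtain ⟨g, hg, hK, h0, h1⟩ := h
  let G : ℝ → K := fun t => ⟨g t, hK t⟩
  have hG : LipschitzWith 1 G := fun s t => hg s t
  let γ : Path x y :=
    { toFun := fun t => G (L * t)
      continuous_toFun := hG.continuous.comp (by fun_prop)
      source' := Subtype.ext (by simpa [G] using h0)
      target' := Subtype.ext (by simpa [G] using h1) }
  refine (iInf_le _ γ).trans ?_
  have h2 : eVariationOn (G ∘ fun t : unitInterval => L * (t : ℝ)) univ ≤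
      (1 : ℝ≥0) * eVariationOn (fun t : unitInterval => L * (t : ℝ)) univ :=
    (hG.lipschitzOnWith (s := univ)).comp_eVariationOn_le (mapsTo_univ _ _)
  refine h2.trans ?_
  rw [ENNReal.coe_one, one_mul]
  have hmono : MonotoneOn (fun t : unitInterval => L * (t : ℝ)) univ := fun s _ t _ hst =>
    mul_le_mul_of_nonneg_left hst hL
  have h3 := (hmono.eVariationOn_eq (mem_univ 0) (mem_univ 1)).le
  have h4 : univ ∩ Icc (0 : unitInterval) 1 = univ := by
    ext t
    simp [unitInterval.le_one']
  rw [h4] at h3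
  simpa using h3

/-- The infimum of the times at which `y` can be reached from `x` in `K` at unit speed. -/
def reachTime (K : Set E) (x y : E) : ℝ := sInf {L | 0 ≤ L ∧ Reach K L x y}

theorem reachTime_le (hL : 0 ≤ L) (h : Reach K L x y) : reachTime K x y ≤ L :=
  csInf_le ⟨0, fun _ h => h.1⟩ ⟨hL, h⟩

theorem reachTime_nonneg : 0 ≤ reachTime K x y := Real.sInf_nonneg fun _ h => h.1

theorem reachTime_self (hx : x ∈ K) : reachTime K x x = 0 :=
  le_antisymm (reachTime_le le_rfl (Reach.refl hx 0)) reachTime_nonneg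

theorem reachTime_le_add (hL : 0 ≤ L) (h : Reach K L x y) (hL' : 0 ≤ L') (hyz : Reach K L' y z) :
    reachTime K x z ≤ L + reachTime K y z := by
  rw [← sub_le_iff_le_add']
  -- Nonemptiness must be supplied, since the infimum of the empty set in `ℝ` is `0`; this is the
  -- role of `L'`.
  refine le_csInf ⟨L', hL', hyz⟩ fun M hM => ?_
  rw [sub_le_iff_le_add']
  exact reachTime_le (add_nonneg hL hM.1) (h.trans hL hM.1 hM.2)

theorem geodesicDist_le_reachTime {x y : K} (hL : 0 ≤ L) (h : Reach K L (x : E) y) :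
    geodesicDist x y ≤ ENNReal.ofReal (reachTime K (x : E) y) := by
  refine ENNReal.le_of_forall_pos_le_add fun ε hε _ => ?_
  obtain ⟨M, hM, hlt⟩ := exists_lt_of_csInf_lt (s := {L | 0 ≤ L ∧ Reach K L (x : E) y}) ⟨L, hL, h⟩
    (lt_add_of_pos_right (reachTime K (x : E) y) (NNReal.coe_pos.2 hε))
  refine (hM.2.geodesicDist_le hM.1).trans ?_
  rw [← ENNReal.ofReal_coe_nnreal, ← ENNReal.ofReal_add reachTime_nonneg ε.coe_nonneg]
  exact ENNReal.ofReal_le_ofReal hlt.le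

end Reach

theorem Reach.of_segment {E : Type*} [NormedAddCommGroup E] [NormedSpace ℝ E] {K : Set E} {u v : E}
    (h : segment ℝ u v ⊆ K) : Reach K (dist u v) u v := by
  rcases eq_or_ne u v with rfl | huv
  · exact Reach.refl (h (left_mem_segment ℝ u u)) _
  have hd : 0 < dist u v := dist_pos.2 huv
  -- Clamping the parameter lets the path rest at the endpoints outside `[0, dist u v]`, as it has
  -- to be defined on all of `ℝ`.
  refine ⟨fun t => AffineMap.lineMap u v (projIcc (0 : ℝ) 1 zero_le_one (t / dist u v) : ℝ),
    LipschitzWith.of_dist_le_mul fun s t => ?_, fun t => h ?_, ?_, ?_⟩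
  · have h1 := (LipschitzWith.projIcc (zero_le_one' ℝ)).dist_le_mul (s / dist u v) (t / dist u v)
    rw [dist_lineMap_lineMap]
    rw [Subtype.dist_eq] at h1
    refine (mul_le_mul_of_nonneg_right h1 hd.le).trans (le_of_eq ?_)
    rw [Real.dist_eq, ← sub_div, abs_div, abs_of_pos hd, Real.dist_eq]
    simp only [NNReal.coe_one]
    field_simp
  · rw [segment_eq_image_lineMap]
    exact ⟨_, (projIcc (0 : ℝ) 1 zero_le_one (t / dist u v)).2, rfl⟩
  · simp
  · simp [div_self hd.ne']

end LengthSpace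

namespace StretchedGasket

open Set Filter Topology LengthSpace

/-! ## Barycentric coordinates and the first-level cells -/

/-- The barycentric coordinates with respect to the vertices of the triangle. -/
def bary (i : Fin 3) (x : Plane) : ℝ :=
  ![1 - x 0 - x 1 / √3, 2 * x 1 / √3, x 0 - x 1 / √3] i

theorem bary_affine (i : Fin 3) (u v : Plane) (s : ℝ) :
    bary i (u + s • (v - u)) = bary i u + s * (bary i v - bary i u) := by
  fin_cases i <;> simp [bary] <;> ring

theorem bary_vertex (i k : Fin 3) : bary i (vertex k) = if i = k then 1 else 0 := by
  have h3 : √3 ≠ 0 := by positivity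
  fin_cases i <;> fin_cases k <;> simp [bary, vertex] <;> field_simp <;> norm_num

theorem sum_bary (x : Plane) : bary 0 x + bary 1 x + bary 2 x = 1 := by
  simp [bary]
  ring

theorem eq_of_bary_eq {x y : Plane} (h : ∀ i, bary i x = bary i y) : x = y := by
  have h3 : √3 ≠ 0 := by positivity
  have h1 := h 1
  have h2 := h 2
  simp only [bary, Matrix.cons_val_one, Matrix.cons_val_two, Matrix.cons_val] at h1 h2
  have e1 : x 1 = y 1 := by
    field_simp at h1
    linarith
  ext k
  fin_cases k
  · rw [e1] at h2
    simpa using h2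
  · exact e1

theorem continuous_bary (i : Fin 3) : Continuous (bary i) := by
  unfold bary
  fin_cases i <;> simp <;> fun_prop

theorem cornerMap_eq (α : ℝ) (i : Fin 3) (x : Plane) :
    cornerMap α i x = vertex i + ((1 - α) / 2) • (x - vertex i) := by
  have h := cornerMap_sub α i x (vertex i)
  rw [cornerMap_vertex, sub_eq_iff_eq_add] at h
  rw [h, add_comm]

theorem bary_cornerMap (α : ℝ) (i k : Fin 3) (x : Plane) :
    bary k (cornerMap α i x) = (1 - α) / 2 * bary k x + if k = i then (1 + α) / 2 else 0 := by
  rw [cornerMap_eq, bary_affine, bary_vertex]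
  split_ifs <;> ring

/-- The linear part is `α` times the orthogonal projection to the direction of the side, so `x` may
be replaced by its foot on the line of that side; the scalar is the parameter of the foot. -/
theorem joinMap_eq_side (α : ℝ) (i : Fin 3) (x : Plane) :
    joinMap α i x = joinMap α i (vertex (i + 1) +
      ((1 + bary (i + 2) x - bary (i + 1) x) / 2) • (vertex (i + 2) - vertex (i + 1))) := by
  have h3 : √3 * √3 = 3 := Real.mul_self_sqrt (by norm_num)
  have h0 : √3 ≠ 0 := by positivity
  obtain ⟨a, b, rfl⟩ : ∃ a b : ℝ, x = !₂[a, b] :=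
    ⟨x 0, x 1, by ext k; fin_cases k <;> rfl⟩
  rw [joinMap_side]
  ext k
  fin_cases i <;> fin_cases k <;>
    simp [joinMap, F, center, linPart, vertex, Fin.natAdd, bary] <;>
    field_simp <;> grind

theorem joinMap_eq (α : ℝ) (i : Fin 3) (x : Plane) :
    joinMap α i x = vertex (i + 1) +
      ((1 + α * (bary (i + 2) x - bary (i + 1) x)) / 2) • (vertex (i + 2) - vertex (i + 1)) := by
  rw [joinMap_eq_side, joinMap_side]
  congr 2
  ring

theorem bary_joinMap_self (α : ℝ) (i : Fin 3) (x : Plane) : bary i (joinMap α i x) = 0 := by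
  rw [joinMap_eq, bary_affine, bary_vertex, bary_vertex, if_neg, if_neg] <;> simp

theorem bary_joinMap_one (α : ℝ) (i : Fin 3) (x : Plane) : bary (i + 1) (joinMap α i x) =
    (1 - α * (bary (i + 2) x - bary (i + 1) x)) / 2 := by
  rw [joinMap_eq, bary_affine, bary_vertex, bary_vertex, if_pos rfl, if_neg (by simp)]
  ring

theorem bary_joinMap_two (α : ℝ) (i : Fin 3) (x : Plane) : bary (i + 2) (joinMap α i x) =
    (1 + α * (bary (i + 2) x - bary (i + 1) x)) / 2 := by
  rw [joinMap_eq, bary_affine, bary_vertex, bary_vertex, if_pos rfl, if_neg (by simp)]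
  ring

theorem sum_bary' (i : Fin 3) (x : Plane) : bary i x + bary (i + 1) x + bary (i + 2) x = 1 := by
  have h := sum_bary x
  fin_cases i
  · exact h
  · change bary 1 x + bary 2 x + bary 0 x = 1
    linarith
  · change bary 2 x + bary 0 x + bary 1 x = 1
    linarith

theorem mem_gasket_iff (α : Param) (x : Plane) : x ∈ gasket α ↔
    (∃ i, ∃ y ∈ gasket α, cornerMap α i y = x) ∨ ∃ i, ∃ y ∈ gasket α, joinMap α i y = x := by
  constructor
  · intro hx
    rw [(gasket_spec α).2.2] at hx
    obtain ⟨j, y, hy, rfl⟩ := mem_iUnion.1 hx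
    refine Fin.addCases (m := 3) (n := 3)
      (motive := fun j => (∃ i, ∃ z ∈ gasket α, cornerMap α i z = F α j y) ∨
        ∃ i, ∃ z ∈ gasket α, joinMap α i z = F α j y)
      (fun i => Or.inl ⟨i, y, hy, rfl⟩) (fun i => Or.inr ⟨i, y, hy, rfl⟩) j
  · rintro (⟨i, y, hy, rfl⟩ | ⟨i, y, hy, rfl⟩) <;> exact F_mem_gasket α _ hy

theorem forall_fin_three_iff (i : Fin 3) (p : Fin 3 → Prop) :
    (∀ k, p k) ↔ p i ∧ p (i + 1) ∧ p (i + 2) := by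
  rw [Fin.forall_fin_succ, Fin.forall_fin_two]
  fin_cases i
  · rfl
  · change p 0 ∧ p 1 ∧ p 2 ↔ p 1 ∧ p 2 ∧ p 0
    tauto
  · change p 0 ∧ p 1 ∧ p 2 ↔ p 2 ∧ p 0 ∧ p 1
    tauto

/-- The gasket is contained in the triangle. -/
theorem bary_nonneg {α : Param} {x : Plane} (hx : x ∈ gasket α) (i : Fin 3) : 0 ≤ bary i x := by
  obtain ⟨hne, hcomp, -⟩ := gasket_spec α
  obtain ⟨h0, h1⟩ := α.2
  have hcont : Continuous fun x : Plane => min (min (bary 0 x) (bary 1 x)) (bary 2 x) :=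
    ((continuous_bary 0).min (continuous_bary 1)).min (continuous_bary 2)
  obtain ⟨z, hz, hmin⟩ := hcomp.exists_isMinOn hne hcont.continuousOn
  set m : ℝ := min (min (bary 0 z) (bary 1 z)) (bary 2 z) with hm
  have hle : ∀ y ∈ gasket α, ∀ k, m ≤ bary k y := by
    intro y hy k
    have h : m ≤ min (min (bary 0 y) (bary 1 y)) (bary 2 y) := hmin hy
    simp only [le_min_iff] at h
    fin_cases k
    exacts [h.1.1, h.1.2, h.2]
  suffices hpos : 0 ≤ m from hpos.trans (hle x hx i)
  -- Minimum principle: each of the six maps sends coordinates at least `m` to coordinates strictly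
  -- above `m` when `m < 0`, yet `z` attains `m`.
  by_contra! hneg
  have key : ∀ k, m < bary k z := by
    rcases (mem_gasket_iff α z).1 hz with ⟨j, y, hy, rfl⟩ | ⟨j, y, hy, rfl⟩
    · intro k
      rw [bary_cornerMap]
      have := hle y hy k
      split_ifs <;> nlinarith
    · have e := sum_bary' j y
      have b0 := hle y hy j
      have b1 := hle y hy (j + 1)
      have b2 := hle y hy (j + 2)
      rw [forall_fin_three_iff j, bary_joinMap_self, bary_joinMap_one, bary_joinMap_two]
      refine ⟨hneg, ?_, ?_⟩ <;> nlinarith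
  have : m < min (min (bary 0 z) (bary 1 z)) (bary 2 z) :=
    lt_min (lt_min (key 0) (key 1)) (key 2)
  exact lt_irrefl _ this

theorem bary_le_one {α : Param} {x : Plane} (hx : x ∈ gasket α) (i : Fin 3) : bary i x ≤ 1 := by
  linarith [sum_bary' i x, bary_nonneg hx (i + 1), bary_nonneg hx (i + 2)]

theorem cornerMap_injective (α : Param) (i : Fin 3) : Function.Injective (cornerMap α i) := by
  intro x y h
  have hc : (1 - (α : ℝ)) / 2 ≠ 0 := by linarith [α.2.2]
  have h' := cornerMap_sub α i x y
  rw [h, sub_self, eq_comm, smul_eq_zero] at h'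
  exact sub_eq_zero.1 (h'.resolve_left hc)

/-- The three corner cells are disjoint. -/
theorem index_eq_of_cornerMap_eq {α : Param} {i j : Fin 3} {x y : Plane} (hx : x ∈ gasket α)
    (hy : y ∈ gasket α) (h : cornerMap α i x = cornerMap α j y) : i = j := by
  obtain ⟨h0, h1⟩ := α.2
  by_contra hij
  -- Coordinate `i` is at least `(1 + α) / 2` in cell `i` and at most `(1 - α) / 2` in the other
  -- cells.
  have e := congrArg (bary i) h
  rw [bary_cornerMap, bary_cornerMap, if_pos rfl, if_neg hij] at e
  have := bary_nonneg hx i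
  have := bary_le_one hy i
  nlinarith

/-- A corner cell meets the joining edges in its vertices only. -/
theorem exists_vertex_of_cornerMap_eq_joinMap {α : Param} {i j : Fin 3} {x y : Plane}
    (hx : x ∈ gasket α) (hy : y ∈ gasket α) (h : cornerMap α i x = joinMap α j y) :
    ∃ k, x = vertex k := by
  obtain ⟨h0, h1⟩ := α.2
  -- Coordinates are at most `(1 + α) / 2` on joining edges, while coordinate `i` is at least that
  -- in cell `i`. Equality forces `bary i x = 0`; coordinate `j` vanishes as well, so `x` is the
  -- third vertex.
  have hjoin : ∀ k, bary k (joinMap α j y) ≤ (1 + α) / 2 := by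
    have b1 := bary_nonneg hy (j + 1)
    have b2 := bary_nonneg hy (j + 2)
    have b1' := bary_le_one hy (j + 1)
    have b2' := bary_le_one hy (j + 2)
    rw [forall_fin_three_iff j, bary_joinMap_self, bary_joinMap_one, bary_joinMap_two]
    refine ⟨?_, ?_, ?_⟩ <;> nlinarith
  have ej := congrArg (bary j) h
  rw [bary_joinMap_self, bary_cornerMap] at ej
  have ei := hjoin i
  rw [← h, bary_cornerMap, if_pos rfl] at ei
  have hij : j ≠ i := by
    rintro rfl
    rw [if_pos rfl] at ej
    nlinarith [bary_nonneg hx j]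
  rw [if_neg hij, add_zero] at ej
  have xj : bary j x = 0 := (mul_eq_zero.1 ej).resolve_left (by linarith)
  have xi : bary i x = 0 := by
    refine le_antisymm ?_ (bary_nonneg hx i)
    by_contra! hpos
    nlinarith
  obtain ⟨k, hki, hkj, hk⟩ : ∃ k : Fin 3, i ≠ k ∧ j ≠ k ∧ Finset.univ = {i, j, k} := by
    revert hij
    clear * -
    revert i j
    decide
  have hs : ∑ l, bary l x = 1 := by rw [Fin.sum_univ_three, sum_bary]
  rw [hk, Finset.sum_insert (by simp [hki, hij.symm]), Finset.sum_pair hkj, xi, xj, zero_add,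
    zero_add] at hs
  refine ⟨k, eq_of_bary_eq fun l => ?_⟩
  have hl : l ∈ ({i, j, k} : Finset (Fin 3)) := hk ▸ Finset.mem_univ l
  simp only [Finset.mem_insert, Finset.mem_singleton] at hl
  rw [bary_vertex]
  rcases hl with rfl | rfl | rfl
  · rw [xi, if_neg hki]
  · rw [xj, if_neg hkj]
  · rw [hs, if_pos rfl]

/-! ## Edges -/

theorem segment_edge_subset (α : Param) (e : Edge) :
    segment ℝ (e.start α) (e.finish α) ⊆ gasket α := by
  rw [segment_eq_image']
  rintro _ ⟨s, hs, rfl⟩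
  exact edge_mem_gasket α e s hs

/-- The image of an edge under the `i`-th corner map. -/
def Edge.cons (i : Fin 3) : Edge → Edge
  | .triangle w j => .triangle (i :: w) j
  | .joining w j => .joining (i :: w) j

theorem Edge.start_cons (α : ℝ) (i : Fin 3) (e : Edge) :
    (e.cons i).start α = cornerMap α i (e.start α) := by
  cases e <;> rfl

theorem Edge.finish_cons (α : ℝ) (i : Fin 3) (e : Edge) :
    (e.cons i).finish α = cornerMap α i (e.finish α) := by
  cases e <;> rfl

theorem cornerMap_affine (α : ℝ) (i : Fin 3) (x y : Plane) (s : ℝ) :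
    cornerMap α i (x + s • (y - x)) =
      cornerMap α i x + s • (cornerMap α i y - cornerMap α i x) :=
  (wordMap_affine α [i] x y s).symm

theorem cornerMap_mem_segment_cons (α : ℝ) (i : Fin 3) (e : Edge) {x : Plane}
    (hx : x ∈ segment ℝ (e.start α) (e.finish α)) :
    cornerMap α i x ∈ segment ℝ ((e.cons i).start α) ((e.cons i).finish α) := by
  rw [segment_eq_image'] at hx ⊢
  obtain ⟨s, hs, rfl⟩ := hx
  refine ⟨s, hs, ?_⟩
  rw [cornerMap_affine, Edge.start_cons, Edge.finish_cons]

theorem edgeCurve_coe (α : Param) (e : Edge) (t : Icc (0 : ℝ) (e.length α)) :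
    (edgeCurve α e t : Plane) =
      e.start α + ((t : ℝ) / e.length α) • (e.finish α - e.start α) := by
  have hl := e.length_pos α
  obtain ⟨t, ht⟩ := t
  change (1 / e.length α) • ((t : ℝ) • e.finish α + (e.length α - t) • e.start α) =
    e.start α + (t / e.length α) • (e.finish α - e.start α)
  clear ht
  generalize e.length α = l at hl
  rw [smul_add, smul_smul, smul_smul, mul_sub, one_div_mul_cancel hl.ne', one_div_mul_eq_div]
  module

theorem dist_edgeCurve (α : Param) (e : Edge) (s t : Icc (0 : ℝ) (e.length α)) :
    dist (edgeCurve α e s) (edgeCurve α e t) = dist s t := by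
  have hl := e.length_pos α
  have hn : ‖e.finish α - e.start α‖ = e.length α := by
    rw [Edge.length, dist_comm, dist_eq_norm]
  rw [Subtype.dist_eq, edgeCurve_coe, edgeCurve_coe, dist_add_left, dist_eq_norm, ← sub_smul,
    norm_smul, hn, ← sub_div, norm_div, Real.norm_of_nonneg hl.le, div_mul_cancel₀ _ hl.ne',
    Subtype.dist_eq, dist_eq_norm]

theorem edgeCurve_mem_segment (α : Param) (e : Edge) (t : Icc (0 : ℝ) (e.length α)) :
    (edgeCurve α e t : Plane) ∈ segment ℝ (e.start α) (e.finish α) := by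
  have hl := e.length_pos α
  rw [segment_eq_image']
  exact ⟨t / e.length α, ⟨div_nonneg t.2.1 hl.le, (div_le_one hl).2 t.2.2⟩,
    (edgeCurve_coe α e t).symm⟩

theorem exists_edgeCurve_eq (α : Param) (e : Edge) {x : Plane}
    (hx : x ∈ segment ℝ (e.start α) (e.finish α)) : ∃ t, (edgeCurve α e t : Plane) = x := by
  have hl := e.length_pos α
  rw [segment_eq_image'] at hx
  obtain ⟨s, hs, rfl⟩ := hx
  refine ⟨⟨s * e.length α, mul_nonneg hs.1 hl.le, mul_le_of_le_one_left hl.le hs.2⟩, ?_⟩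
  rw [edgeCurve_coe, mul_div_cancel_right₀ _ hl.ne']

theorem joinMap_mem_segment (α : Param) (i : Fin 3) {x : Plane} (hx : x ∈ gasket α) :
    joinMap α i x ∈
      segment ℝ ((Edge.joining [] i).start α) ((Edge.joining [] i).finish α) := by
  have b1 := bary_nonneg hx (i + 1)
  have b2 := bary_nonneg hx (i + 2)
  have b1' := bary_le_one hx (i + 1)
  have b2' := bary_le_one hx (i + 2)
  have e0 := joinMap_side α i 0
  have e1 := joinMap_side α i 1
  simp only [zero_smul, add_zero, one_smul, add_sub_cancel] at e0 e1
  rw [segment_eq_image']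
  refine ⟨(1 + bary (i + 2) x - bary (i + 1) x) / 2, ⟨by linarith, by linarith⟩, ?_⟩
  change joinMap α i (vertex (i + 1)) + _ •
    (joinMap α i (vertex (i + 2)) - joinMap α i (vertex (i + 1))) = _
  rw [e0, e1, joinMap_eq]
  module

theorem joinMap_mem_side (α : Param) (i : Fin 3) {x : Plane} (hx : x ∈ gasket α) :
    joinMap α i x ∈ segment ℝ (vertex (i + 1)) (vertex (i + 2)) := by
  obtain ⟨h0, h1⟩ := α.2
  have b1 := bary_nonneg hx (i + 1)
  have b2 := bary_nonneg hx (i + 2)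
  have b1' := bary_le_one hx (i + 1)
  have b2' := bary_le_one hx (i + 2)
  rw [joinMap_eq, segment_eq_image']
  exact ⟨_, ⟨by nlinarith, by nlinarith⟩, rfl⟩

theorem exists_edge_of_vertex_ne {i k : Fin 3} (h : i ≠ k) :
    ∃ j, (i = j + 1 ∧ k = j + 2) ∨ (i = j + 2 ∧ k = j + 1) := by
  revert i k
  decide

theorem vertex_mem_gasket (α : Param) (k : Fin 3) : vertex k ∈ gasket α := by
  have h := side_mem_gasket α (k + 2) 0 ⟨le_rfl, zero_le_one⟩
  rw [zero_smul, add_zero, add_assoc] at h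
  simpa using h

theorem segment_vertex_subset (α : Param) (i k : Fin 3) :
    segment ℝ (vertex i) (vertex k) ⊆ gasket α := by
  rcases eq_or_ne i k with rfl | hik
  · rw [segment_same]
    exact singleton_subset_iff.2 (vertex_mem_gasket α i)
  · obtain ⟨j, ⟨rfl, rfl⟩ | ⟨rfl, rfl⟩⟩ := exists_edge_of_vertex_ne hik
    · exact segment_edge_subset α (.triangle [] j)
    · rw [segment_symm]
      exact segment_edge_subset α (.triangle [] j)

theorem dist_vertex_le_one (i k : Fin 3) : dist (vertex i) (vertex k) ≤ 1 := by
  have h3 : √3 ^ 2 = 3 := Real.sq_sqrt (by norm_num)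
  rw [EuclideanSpace.dist_eq, Real.sqrt_le_iff, Fin.sum_univ_two]
  refine ⟨zero_le_one, ?_⟩
  fin_cases i <;> fin_cases k <;> simp [vertex, Real.dist_eq, div_pow, h3] <;> norm_num

theorem dist_cornerMap (α : Param) (i : Fin 3) (x y : Plane) :
    dist (cornerMap α i x) (cornerMap α i y) = (1 - α) / 2 * dist x y := by
  rw [dist_eq_norm, cornerMap_sub, norm_smul, Real.norm_of_nonneg (by linarith [α.2.2]),
    dist_eq_norm]

/-- To check a property near a point of the gasket, it is enough to check it on each of the six
pieces of the gasket which contain the point. -/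
theorem eventually_nhdsWithin_gasket {α : Param} {x : Plane} {p : Plane → Prop}
    (hcorner : ∀ i, ∀ y ∈ gasket α, cornerMap α i y = x →
      ∀ᶠ z in 𝓝[gasket α] y, p (cornerMap α i z))
    (hjoin : ∀ i, x ∈ joinMap α i '' gasket α → ∀ z ∈ joinMap α i '' gasket α, p z) :
    ∀ᶠ z in 𝓝[gasket α] x, p z := by
  obtain ⟨h0, h1⟩ := α.2
  have hc : 0 < (1 - (α : ℝ)) / 2 := by linarith
  rw [(gasket_spec α).2.2, nhdsWithin_iUnion, eventually_iSup]
  intro j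
  -- The pieces are closed, so one that misses `x` imposes no condition near `x`.
  by_cases hx : x ∈ F α j '' gasket α
  swap
  · have hcl : IsClosed (F α j '' gasket α) :=
      ((gasket_spec α).2.1.image (lipschitzWith_F h0 h1 j).continuous).isClosed
    have : 𝓝[F α j '' gasket α] x = ⊥ := by
      rwa [← notMem_closure_iff_nhdsWithin_eq_bot, hcl.closure_eq]
    rw [this]
    exact eventually_bot
  revert hx
  refine Fin.addCases (m := 3) (n := 3) (motive := fun j => x ∈ F α j '' gasket α →
    ∀ᶠ z in 𝓝[F α j '' gasket α] x, p z) (fun i hx => ?_) (fun i hx => ?_) j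
  · obtain ⟨y, hy, hyx⟩ := hx
    have h := hcorner i y hy hyx
    rw [eventually_nhdsWithin_iff, Metric.eventually_nhds_iff] at h ⊢
    obtain ⟨ε, hε, h⟩ := h
    refine ⟨(1 - α) / 2 * ε, mul_pos hc hε, ?_⟩
    rintro _ hz ⟨z, hzK, rfl⟩
    refine h ?_ hzK
    rw [← hyx] at hz
    have hz' : dist (cornerMap α i z) (cornerMap α i y) < (1 - α) / 2 * ε := hz
    rw [dist_cornerMap] at hz'
    exact lt_of_mul_lt_mul_left hz' hc.le
  · filter_upwards [self_mem_nhdsWithin] with z hz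
    exact hjoin i hx z hz

/-! ## Paths in the gasket -/

theorem reach_vertex_cornerMap (α : Param) (i k : Fin 3) :
    Reach (gasket α) 1 (vertex k) (cornerMap α i (vertex k)) := by
  obtain ⟨h0, h1⟩ := α.2
  have hmem : cornerMap α i (vertex k) ∈ segment ℝ (vertex i) (vertex k) := by
    rw [segment_eq_image', cornerMap_eq]
    exact ⟨(1 - α) / 2, ⟨by linarith, by linarith⟩, rfl⟩
  have hseg : segment ℝ (vertex k) (cornerMap α i (vertex k)) ⊆ gasket α :=
    ((convex_segment _ _).segment_subset (right_mem_segment ℝ _ _) hmem).trans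
      (segment_vertex_subset α i k)
  refine (Reach.of_segment hseg).mono dist_nonneg ?_
  rw [cornerMap_eq, dist_comm, dist_eq_norm]
  have : vertex i + ((1 - (α : ℝ)) / 2) • (vertex k - vertex i) - vertex k =
      ((1 + (α : ℝ)) / 2) • (vertex i - vertex k) := by module
  rw [this, norm_smul, ← dist_eq_norm, Real.norm_of_nonneg (by linarith)]
  have := dist_vertex_le_one i k
  nlinarith [dist_nonneg (x := vertex i) (y := vertex k)]

theorem reach_vertex_vertex (α : Param) (i k : Fin 3) :
    Reach (gasket α) 1 (vertex i) (vertex k) :=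
  (Reach.of_segment (segment_vertex_subset α i k)).mono dist_nonneg (dist_vertex_le_one i k)

theorem reach_vertex_joinMap (α : Param) (i k : Fin 3) {x : Plane} (hx : x ∈ gasket α) :
    Reach (gasket α) 2 (vertex k) (joinMap α i x) := by
  have hmem := joinMap_mem_side α i hx
  have hseg : segment ℝ (vertex (i + 1)) (joinMap α i x) ⊆ gasket α :=
    ((convex_segment _ _).segment_subset (left_mem_segment ℝ _ _) hmem).trans
      (segment_vertex_subset α _ _)
  have hd : dist (vertex (i + 1)) (joinMap α i x) ≤ 1 := by
    have h := dist_add_dist_of_mem_segment hmem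
    have := dist_vertex_le_one (i + 1) (i + 2)
    linarith [dist_nonneg (x := joinMap α i x) (y := vertex (i + 2))]
  have h := (reach_vertex_vertex α k (i + 1)).trans zero_le_one dist_nonneg (Reach.of_segment hseg)
  exact h.mono (by positivity) (by linarith)

theorem reach_image_cornerMap (α : Param) (i : Fin 3) {L : ℝ} {x y : Plane}
    (h : Reach (gasket α) L x y) :
    Reach (gasket α) ((1 - α) / 2 * L) (cornerMap α i x) (cornerMap α i y) :=
  h.image (by linarith [α.2.2]) (fun u v => (dist_cornerMap α i u v).le)
    (fun _ hu => F_mem_gasket α _ hu)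

/-- The bound `2` reproduces itself: a route to a corner cell costs at most `1` along a side to a
vertex of the cell, then at most `(1 - α) / 2 * 2 < 1` inside it. The points reached are dense, and
`isClosed_setOf_reach` then yields all points. -/
theorem exists_near_reach (α : Param) (n : ℕ) : ∀ x ∈ gasket α, ∃ y,
    dist x y ≤ ((1 - α) / 2) ^ n * Metric.diam (gasket α) ∧
      ∀ k, Reach (gasket α) 2 (vertex k) y := by
  obtain ⟨h0, h1⟩ := α.2
  have hc : 0 < (1 - (α : ℝ)) / 2 := by linarith
  induction n with
  | zero =>
    intro x hx
    refine ⟨vertex 0, ?_, fun k => (reach_vertex_vertex α k 0).mono zero_le_one (by norm_num)⟩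
    rw [pow_zero, one_mul]
    exact Metric.dist_le_diam_of_mem (gasket_spec α).2.1.isBounded hx (vertex_mem_gasket α 0)
  | succ n ih =>
    intro x hx
    rcases (mem_gasket_iff α x).1 hx with ⟨i, y, hy, rfl⟩ | ⟨i, y, hy, rfl⟩
    · obtain ⟨z, hz, hr⟩ := ih y hy
      refine ⟨cornerMap α i z, ?_, fun k => ?_⟩
      · rw [dist_cornerMap, pow_succ', mul_assoc]
        exact mul_le_mul_of_nonneg_left hz hc.le
      · have h := (reach_vertex_cornerMap α i k).trans zero_le_one (by positivity)
          (reach_image_cornerMap α i (hr k))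
        exact h.mono (by positivity) (by linarith)
    · refine ⟨_, ?_, fun k => reach_vertex_joinMap α i k hy⟩
      rw [dist_self]
      exact mul_nonneg (pow_nonneg hc.le _) Metric.diam_nonneg

theorem tendsto_pow_mul (α : Param) (D : ℝ) :
    Tendsto (fun n : ℕ => ((1 - (α : ℝ)) / 2) ^ n * D) atTop (𝓝 0) := by
  obtain ⟨h0, h1⟩ := α.2
  simpa using (tendsto_pow_atTop_nhds_zero_of_lt_one (r := (1 - (α : ℝ)) / 2) (by linarith)
    (by linarith)).mul_const D

theorem reach_vertex (α : Param) (k : Fin 3) {x : Plane} (hx : x ∈ gasket α) :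
    Reach (gasket α) 2 (vertex k) x := by
  choose y hy hr using fun n => exists_near_reach α n x hx
  have hlim : Tendsto y atTop (𝓝 x) := by
    rw [tendsto_iff_dist_tendsto_zero]
    refine squeeze_zero (fun _ => dist_nonneg) (fun n => ?_)
      (tendsto_pow_mul α (Metric.diam (gasket α)))
    rw [dist_comm]
    exact hy n
  exact (isClosed_setOf_reach (gasket_spec α).2.1 2 (vertex k)).mem_of_tendsto hlim
    (Eventually.of_forall fun n => hr n k)

/-- Any two points of the gasket are joined by a path of length at most `4`. -/
theorem reach_four (α : Param) {x y : Plane} (hx : x ∈ gasket α) (hy : y ∈ gasket α) :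
    Reach (gasket α) 4 x y := by
  have h := (reach_vertex α 0 hx).symm.trans (by norm_num) (by norm_num) (reach_vertex α 0 hy)
  norm_num at h
  exact h

/-- Points of a common cell of level `n` are joined at cost `4 ((1 - α) / 2) ^ n`, points of a
common joining edge by a segment. The term `dist x z` scales exactly under the corner maps, so the
sum of both costs survives the induction. -/
theorem eventually_reach (α : Param) (n : ℕ) : ∀ x ∈ gasket α, ∀ᶠ z in 𝓝[gasket α] x,
    Reach (gasket α) (((1 - α) / 2) ^ n * 4 + dist x z) x z := by
  obtain ⟨h0, h1⟩ := α.2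
  have hc : 0 < (1 - (α : ℝ)) / 2 := by linarith
  induction n with
  | zero =>
    intro x hx
    filter_upwards [self_mem_nhdsWithin] with z hz
    exact (reach_four α hx hz).mono (by norm_num) (by simp)
  | succ n ih =>
    intro x hx
    refine eventually_nhdsWithin_gasket (fun i y hy hyx => ?_) fun i hxi z hzi => ?_
    · filter_upwards [ih y hy] with z hz
      have h := reach_image_cornerMap α i hz
      rw [mul_add, ← mul_assoc, ← pow_succ', ← dist_cornerMap α i] at h
      rwa [← hyx]
    · obtain ⟨x', hx', rfl⟩ := hxi
      obtain ⟨z', hz', rfl⟩ := hzi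
      refine (Reach.of_segment (((convex_segment _ _).segment_subset (joinMap_mem_segment α i hx')
        (joinMap_mem_segment α i hz')).trans (segment_edge_subset α _))).mono dist_nonneg ?_
      have := pow_pos hc (n + 1)
      linarith

theorem abs_reachTime_sub_le (α : Param) {L : ℝ} (hL : 0 ≤ L) {x z y : Plane}
    (h : Reach (gasket α) L x z) (hy : y ∈ gasket α) :
    |reachTime (gasket α) x y - reachTime (gasket α) z y| ≤ L := by
  rw [abs_sub_le_iff]
  constructor
  · linarith [reachTime_le_add hL h (by norm_num) (reach_four α h.right_mem hy)]
  · linarith [reachTime_le_add hL h.symm (by norm_num) (reach_four α h.left_mem hy)]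

theorem continuousOn_reachTime (α : Param) {y : Plane} (hy : y ∈ gasket α) :
    ContinuousOn (fun x => reachTime (gasket α) x y) (gasket α) := by
  obtain ⟨h0, h1⟩ := α.2
  have hc : 0 < (1 - (α : ℝ)) / 2 := by linarith
  intro x hx
  refine Metric.tendsto_nhds.2 fun ε hε => ?_
  obtain ⟨n, hn⟩ := ((tendsto_pow_mul α 4).eventually (gt_mem_nhds (half_pos hε))).exists
  have hnear : ∀ᶠ z in 𝓝[gasket α] x, dist z x < ε / 2 :=
    (Metric.eventually_nhds_iff.2 ⟨ε / 2, half_pos hε, fun _ h => h⟩).filter_mono nhdsWithin_le_nhds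
  filter_upwards [eventually_reach α n x hx, hnear] with z hz hzx
  have h := abs_reachTime_sub_le α (by positivity) hz hy
  rw [dist_comm] at hzx
  rw [Real.dist_eq, abs_sub_comm]
  linarith

/-! ## Approximation of functions which are nonexpanding along the edges -/

/-- A function on the gasket which is `1`-Lipschitz on every edge. -/
def IsEdgeLipschitz (α : ℝ) (f : Plane → ℝ) : Prop :=
  ∀ e : Edge, LipschitzOnWith 1 f (segment ℝ (e.start α) (e.finish α))

theorem IsEdgeLipschitz.abs_sub_le {α : ℝ} {f : Plane → ℝ} (hf : IsEdgeLipschitz α f) (e : Edge)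
    {x y : Plane} (hx : x ∈ segment ℝ (e.start α) (e.finish α))
    (hy : y ∈ segment ℝ (e.start α) (e.finish α)) : |f x - f y| ≤ dist x y := by
  simpa [Real.dist_eq] using (hf e).dist_le_mul x hx y hy

theorem IsEdgeLipschitz.abs_vertex_sub_le {α : ℝ} {f : Plane → ℝ} (hf : IsEdgeLipschitz α f)
    (i k : Fin 3) : |f (vertex i) - f (vertex k)| ≤ dist (vertex i) (vertex k) := by
  rcases eq_or_ne i k with rfl | hik
  · simp
  · obtain ⟨j, ⟨rfl, rfl⟩ | ⟨rfl, rfl⟩⟩ := exists_edge_of_vertex_ne hik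
    · exact hf.abs_sub_le (.triangle [] j) (left_mem_segment ℝ _ _) (right_mem_segment ℝ _ _)
    · exact hf.abs_sub_le (.triangle [] j) (right_mem_segment ℝ _ _) (left_mem_segment ℝ _ _)

/-- Corner maps send edges to edges, so the class is invariant under passing to a cell; this drives
the induction on the level. -/
theorem IsEdgeLipschitz.rescale {α : Param} {f : Plane → ℝ} (hf : IsEdgeLipschitz α f) (i : Fin 3) :
    IsEdgeLipschitz α fun x => ((1 - (α : ℝ)) / 2)⁻¹ * f (cornerMap α i x) := by
  have hc : 0 < (1 - (α : ℝ)) / 2 := by linarith [α.2.2]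
  intro e
  refine LipschitzOnWith.of_dist_le_mul fun x hx y hy => ?_
  have h := hf.abs_sub_le (e.cons i) (cornerMap_mem_segment_cons α i e hx)
    (cornerMap_mem_segment_cons α i e hy)
  rw [dist_cornerMap] at h
  rw [Real.dist_eq, ← mul_sub, abs_mul, abs_of_pos (inv_pos.2 hc), inv_mul_le_iff₀ hc,
    NNReal.coe_one, one_mul]
  exact h

/-- A function which is `1`-Lipschitz on the edges is approximated by functions which are locally
nonexpanding on the gasket. -/
theorem exists_locallyNonexpandingOn_near (α : Param) (n : ℕ) :
    ∀ f : Plane → ℝ, IsEdgeLipschitz α f → ∃ g : Plane → ℝ, LocallyNonexpandingOn g (gasket α) ∧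
      (∀ k, g (vertex k) = f (vertex k)) ∧
      ∀ x ∈ gasket α, ∃ y ∈ gasket α,
        dist x y ≤ ((1 - α) / 2) ^ n * Metric.diam (gasket α) ∧
        |f y - g x| ≤ ((1 - α) / 2) ^ n * Metric.diam (gasket α) := by
  obtain ⟨h0, h1⟩ := α.2
  have hc : 0 < (1 - (α : ℝ)) / 2 := by linarith
  induction n with
  | zero =>
    intro f hf
    -- At level `0` only the vertex values of `f` are kept, and they are extended by McShane's
    -- theorem.
    have hlip : LipschitzOnWith 1 f (range vertex) := by
      refine LipschitzOnWith.of_dist_le_mul ?_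
      rintro _ ⟨i, rfl⟩ _ ⟨k, rfl⟩
      simpa [Real.dist_eq] using hf.abs_vertex_sub_le i k
    obtain ⟨g, hg, hgf⟩ := hlip.extend_real
    refine ⟨g, LocallyNonexpandingOn.of_lipschitzOnWith hg.lipschitzOnWith,
      fun k => (hgf (mem_range_self k)).symm, fun x hx =>
      ⟨vertex 0, vertex_mem_gasket α 0, ?_⟩⟩
    have hd : dist x (vertex 0) ≤ Metric.diam (gasket α) :=
      Metric.dist_le_diam_of_mem (gasket_spec α).2.1.isBounded hx (vertex_mem_gasket α 0)
    rw [pow_zero, one_mul]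
    refine ⟨hd, ?_⟩
    rw [hgf (mem_range_self 0), abs_sub_comm]
    have := hg.dist_le_mul x (vertex 0)
    rw [NNReal.coe_one, one_mul, Real.dist_eq] at this
    exact this.trans hd
  | succ n ih =>
    intro f hf
    choose g hloc hvert hnear using fun i => ih _ (hf.rescale i)
    classical
    -- The choice in the definition is harmless: the cells are disjoint and the corner maps
    -- injective (`hGc`).
    let G : Plane → ℝ := fun x =>
      if h : ∃ q : Fin 3 × gasket α, cornerMap α q.1 q.2 = x then
        (1 - α) / 2 * g h.choose.1 h.choose.2 else f x
    have hGc : ∀ i, ∀ x ∈ gasket α, G (cornerMap α i x) = (1 - α) / 2 * g i x := by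
      intro i x hx
      have h : ∃ q : Fin 3 × gasket α, cornerMap α q.1 q.2 = cornerMap α i x := ⟨(i, ⟨x, hx⟩), rfl⟩
      simp only [G, dif_pos h]
      have hi := index_eq_of_cornerMap_eq h.choose.2.2 hx h.choose_spec
      have hx' := cornerMap_injective α i (hi ▸ h.choose_spec)
      rw [hi, hx']
    have hGj : ∀ i, ∀ x ∈ gasket α, G (joinMap α i x) = f (joinMap α i x) := by
      intro i x hx
      by_cases h : ∃ q : Fin 3 × gasket α, cornerMap α q.1 q.2 = joinMap α i x
      -- Such a point is a vertex of its cell, where the approximation keeps the value of `f`; the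
      -- clause on vertices in the induction serves this purpose.
      · obtain ⟨⟨l, y, hy⟩, hq⟩ := h
        obtain ⟨k, rfl⟩ := exists_vertex_of_cornerMap_eq_joinMap hy hx hq
        rw [← hq, hGc l _ hy, hvert, mul_inv_cancel_left₀ hc.ne']
      · simp only [G, dif_neg h]
    refine ⟨G, fun x hx => ?_, fun k => ?_, fun x hx => ?_⟩
    · refine eventually_nhdsWithin_gasket (fun i y hy hyx => ?_) fun i hxi z hzi => ?_
      · filter_upwards [hloc i y hy, self_mem_nhdsWithin] with z hz hzK
        rw [← hyx, hGc i z hzK, hGc i y hy, ← mul_sub, abs_mul, abs_of_pos hc, dist_cornerMap]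
        exact mul_le_mul_of_nonneg_left hz hc.le
      · obtain ⟨x', hx', rfl⟩ := hxi
        obtain ⟨z', hz', rfl⟩ := hzi
        rw [hGj i x' hx', hGj i z' hz']
        exact hf.abs_sub_le _ (joinMap_mem_segment α i hz') (joinMap_mem_segment α i hx')
    · have h := hGc k _ (vertex_mem_gasket α k)
      rw [hvert, mul_inv_cancel_left₀ hc.ne', cornerMap_vertex] at h
      exact h
    · rcases (mem_gasket_iff α x).1 hx with ⟨i, y, hy, rfl⟩ | ⟨i, y, hy, rfl⟩
      · obtain ⟨z, hz, hd, hfz⟩ := hnear i y hy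
        refine ⟨cornerMap α i z, F_mem_gasket α _ hz, ?_, ?_⟩
        · rw [dist_cornerMap, pow_succ', mul_assoc]
          exact mul_le_mul_of_nonneg_left hd hc.le
        · rw [hGc i y hy, pow_succ', mul_assoc]
          refine le_of_eq_of_le ?_ (mul_le_mul_of_nonneg_left hfz hc.le)
          rw [← abs_of_pos hc, ← abs_mul, abs_of_pos hc, mul_sub, mul_inv_cancel_left₀ hc.ne']
      · have hnn : 0 ≤ ((1 - (α : ℝ)) / 2) ^ (n + 1) * Metric.diam (gasket α) :=
          mul_nonneg (pow_nonneg hc.le _) Metric.diam_nonneg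
        refine ⟨_, hx, by rwa [dist_self], ?_⟩
        rwa [hGj i y hy, sub_self, abs_zero]

/-! ## Comparison of the distances -/

theorem commutatorNormLE_rep_iff (α : Param) (f : C(gasket α, ℂ)) :
    SpectralTriple.CommutatorNormLE (dirac α) (rep α f) 1 ↔
      ∀ e, LipschitzWith 1 (f ∘ edgeCurve α e) :=
  SpectralTriple.commutatorNormLE_curveSumRep_iff (edgeCurve α) f

theorem spectralDist_le_pathLength (α : Param) {x y : gasket α} (γ : Path x y) :
    spectralDist α x y ≤ pathLength γ := by
  refine iSup₂_le fun f hf => ?_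
  rw [commutatorNormLE_rep_iff] at hf
  classical
  -- After rotation by `u` the real part alone carries `‖f x - f y‖`, which reduces the estimate to
  -- a real function.
  obtain ⟨u, hu, huf⟩ : ∃ u : ℂ, ‖u‖ = 1 ∧ (u * (f x - f y)).re = ‖f x - f y‖ := by
    obtain ⟨u, hu, h⟩ := RCLike.exists_norm_eq_mul_self (f x - f y)
    exact ⟨u, hu, by rw [← h]; exact Complex.ofReal_re _⟩
  let φ : Plane → ℝ := fun p => if hp : p ∈ gasket α then (u * f ⟨p, hp⟩).re else 0
  have hφ : ∀ p : gasket α, φ p = (u * f p).re := fun p => dif_pos p.2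
  have hφf : ∀ p q : gasket α, |φ p - φ q| ≤ ‖f p - f q‖ := by
    intro p q
    rw [hφ, hφ, ← Complex.sub_re, ← mul_sub]
    refine (Complex.abs_re_le_norm _).trans ?_
    rw [norm_mul, hu, one_mul]
  have hedge : IsEdgeLipschitz α φ := by
    intro e
    refine LipschitzOnWith.of_dist_le_mul fun p hp q hq => ?_
    obtain ⟨s, rfl⟩ := exists_edgeCurve_eq α e hp
    obtain ⟨t, rfl⟩ := exists_edgeCurve_eq α e hq
    rw [Real.dist_eq]
    refine (hφf _ _).trans ?_
    rw [← dist_eq_norm, ← Subtype.dist_eq, dist_edgeCurve]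
    exact (hf e).dist_le_mul s t
  refine ENNReal.le_of_forall_pos_le_add fun ε hε _ => ?_
  have hε4 : (0 : ℝ) < ε / 4 := div_pos (NNReal.coe_pos.2 hε) (by norm_num)
  obtain ⟨δ, hδ, hunif⟩ := Metric.uniformContinuous_iff.1
    (CompactSpace.uniformContinuous_of_continuous f.continuous) (ε / 4) hε4
  -- The approximation compares `g p` with `φ` at a nearby point `q` only. Uniform continuity bounds
  -- `|φ p - φ q|` by `ε / 4`, and the approximation error is another `ε / 4`; two endpoints give
  -- `ε` in total.
  obtain ⟨n, hn⟩ := ((tendsto_pow_mul α (Metric.diam (gasket α))).eventually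
    (gt_mem_nhds (lt_min hδ hε4))).exists
  obtain ⟨g, hg, -, hnear⟩ := exists_locallyNonexpandingOn_near α n φ hedge
  have happ : ∀ p : gasket α, |φ p - g p| ≤ ε / 2 := by
    intro p
    obtain ⟨q, hq, hd, hpq⟩ := hnear p p.2
    have h1 := hφf p ⟨q, hq⟩
    have h2 := hunif (a := p) (b := ⟨q, hq⟩) (hd.trans_lt (hn.trans_le (min_le_left _ _)))
    rw [dist_eq_norm] at h2
    have h3 := hn.trans_le (min_le_right _ _)
    have h4 := abs_sub_le (φ p) (φ q) (g p)
    linarith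
  have hlen := hg.edist_le_pathLength γ
  have hmain : ‖f x - f y‖ ≤ dist (g x) (g y) + ε := by
    rw [← huf, mul_sub, Complex.sub_re, ← hφ, ← hφ, Real.dist_eq]
    have h1 := abs_le.1 (happ x)
    have h2 := abs_le.1 (happ y)
    have h3 := le_abs_self (g x - g y)
    linarith
  refine (ENNReal.ofReal_le_ofReal hmain).trans ?_
  rw [ENNReal.ofReal_add dist_nonneg ε.coe_nonneg, ← edist_dist, ENNReal.ofReal_coe_nnreal]
  gcongr

/-- The intrinsic distance to `y` is the extremal function: it is admissible and vanishes at `y`. -/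
theorem geodesicDist_le_spectralDist (α : Param) (x y : gasket α) :
    geodesicDist x y ≤ spectralDist α x y := by
  let f : C(gasket α, ℂ) :=
    ⟨fun p => (reachTime (gasket α) (p : Plane) y : ℂ), Complex.continuous_ofReal.comp
      (continuousOn_iff_continuous_domRestrict.1 (continuousOn_reachTime α y.2))⟩
  have hf : SpectralTriple.CommutatorNormLE (dirac α) (rep α f) 1 := by
    rw [commutatorNormLE_rep_iff]
    intro e
    refine LipschitzWith.of_dist_le_mul fun s t => ?_
    rw [NNReal.coe_one, one_mul, ← dist_edgeCurve]
    change dist (reachTime (gasket α) (edgeCurve α e s : Plane) y : ℂ)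
      (reachTime (gasket α) (edgeCurve α e t : Plane) y : ℂ) ≤ _
    rw [dist_eq_norm, ← Complex.ofReal_sub, Complex.norm_real]
    exact abs_reachTime_sub_le α dist_nonneg (Reach.of_segment
      (((convex_segment _ _).segment_subset (edgeCurve_mem_segment α e s)
        (edgeCurve_mem_segment α e t)).trans (segment_edge_subset α e))) y.2
  refine (geodesicDist_le_reachTime (by norm_num) (reach_four α x.2 y.2)).trans ?_
  refine le_trans (le_of_eq ?_) (le_iSup₂_of_le f hf le_rfl)
  change _ = ENNReal.ofReal ‖(reachTime (gasket α) (x : Plane) y : ℂ) -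
    (reachTime (gasket α) (y : Plane) y : ℂ)‖
  rw [reachTime_self y.2, Complex.ofReal_zero, sub_zero, Complex.norm_real,
    Real.norm_of_nonneg reachTime_nonneg]

theorem geodesicDist_ne_top (α : Param) (x y : gasket α) : geodesicDist x y ≠ ⊤ :=
  ne_top_of_le_ne_top ENNReal.ofReal_ne_top
    ((reach_four α x.2 y.2).geodesicDist_le (by norm_num))

/-! ## Failure of the second axiom of Lapidus and Sarhad -/

/-- The union of the three corner cells. -/
def cornerCells (α : Param) : Set Plane := ⋃ i, cornerMap α i '' gasket α

theorem isClosed_cornerCells (α : Param) : IsClosed (cornerCells α) :=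
  isClosed_iUnion_of_finite fun _ =>
    ((gasket_spec α).2.1.image (lipschitzWith_F α.2.1 α.2.2 _).continuous).isClosed

theorem cornerMap_mem_cornerCells (α : Param) (i : Fin 3) {x : Plane} (hx : x ∈ gasket α) :
    cornerMap α i x ∈ cornerCells α :=
  mem_iUnion.2 ⟨i, x, hx, rfl⟩

theorem wordMap_mem_cornerCells (α : Param) (w : List (Fin 3)) {x : Plane} (hx : x ∈ gasket α)
    (hx' : x ∈ cornerCells α) : wordMap α w x ∈ cornerCells α := by
  cases w with
  | nil => exact hx'
  | cons i w => exact cornerMap_mem_cornerCells α i (wordMap_mem_gasket α w hx)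

theorem vertex_mem_cornerCells (α : Param) (k : Fin 3) : vertex k ∈ cornerCells α := by
  rw [← cornerMap_vertex α k]
  exact cornerMap_mem_cornerCells α k (vertex_mem_gasket α k)

theorem joinMap_vertex_one (α : ℝ) (i : Fin 3) :
    joinMap α i (vertex (i + 1)) = cornerMap α (i + 1) (vertex (i + 2)) := by
  have e0 := joinMap_side α i 0
  simp only [zero_smul, add_zero] at e0
  rw [e0, cornerMap_eq]
  congr 2
  ring

theorem joinMap_vertex_two (α : ℝ) (i : Fin 3) :
    joinMap α i (vertex (i + 2)) = cornerMap α (i + 2) (vertex (i + 1)) := by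
  have e1 := joinMap_side α i 1
  simp only [one_smul, add_sub_cancel] at e1
  rw [e1, cornerMap_eq]
  module

theorem Edge.start_mem_cornerCells (α : Param) (e : Edge) : e.start α ∈ cornerCells α := by
  cases e with
  | triangle w i =>
    exact wordMap_mem_cornerCells α w (vertex_mem_gasket α _) (vertex_mem_cornerCells α _)
  | joining w i =>
    refine wordMap_mem_cornerCells α w (F_mem_gasket α _ (vertex_mem_gasket α _)) ?_
    rw [joinMap_vertex_one]
    exact cornerMap_mem_cornerCells α _ (vertex_mem_gasket α _)

theorem Edge.finish_mem_cornerCells (α : Param) (e : Edge) : e.finish α ∈ cornerCells α := by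
  cases e with
  | triangle w i =>
    exact wordMap_mem_cornerCells α w (vertex_mem_gasket α _) (vertex_mem_cornerCells α _)
  | joining w i =>
    refine wordMap_mem_cornerCells α w (F_mem_gasket α _ (vertex_mem_gasket α _)) ?_
    rw [joinMap_vertex_two]
    exact cornerMap_mem_cornerCells α _ (vertex_mem_gasket α _)

/-- The midpoint of a joining edge lies in no corner cell. -/
theorem exists_mem_gasket_notMem_cornerCells (α : Param) : ∃ x ∈ gasket α, x ∉ cornerCells α := by
  obtain ⟨h0, h1⟩ := α.2
  refine ⟨_, side_mem_gasket α 0 (1 / 2) ⟨by norm_num, by norm_num⟩, fun h => ?_⟩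
  obtain ⟨i, y, hy, h⟩ := mem_iUnion.1 h
  -- The midpoint has coordinates `0, 1/2, 1/2`, whereas coordinate `i` is at least `(1 + α) / 2 >
  -- 1/2` in cell `i`.
  have e := congrArg (bary i) h
  rw [bary_cornerMap, if_pos rfl, bary_affine, bary_vertex, bary_vertex] at e
  have hq : 0 ≤ (1 - (α : ℝ)) / 2 * bary i y := mul_nonneg (by linarith) (bary_nonneg hy i)
  generalize (1 - (α : ℝ)) / 2 * bary i y = q at e hq
  fin_cases i <;> simp at e <;> linarith

end StretchedGasket

namespace LengthSpace

open Set Filter Topology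

/-- A monotone or antitone surjection onto `[0, l]` takes an extreme value at the left end of its
interval. -/
theorem Traverses.apply_left {X : Type*} [PseudoEMetricSpace X] {x y : X} {γ : Path x y}
    {a b : unitInterval} (hab : a ≤ b) {l : ℝ} (hl : 0 ≤ l) {R : C(Icc (0 : ℝ) l, X)}
    (h : Traverses γ a b R) : γ a = R ⟨0, le_rfl, hl⟩ ∨ γ a = R ⟨l, hl, le_rfl⟩ := by
  obtain ⟨φ, hφ, himg, hγ⟩ := h
  have ha : a ∈ Icc a b := left_mem_Icc.2 hab
  rw [hγ a ha]
  rcases hφ with hφ | hφ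
  · left
    obtain ⟨s, hs, hs0⟩ := himg.symm.subset (mem_univ ⟨0, le_rfl, hl⟩)
    refine congrArg R (le_antisymm ?_ (φ a).2.1)
    exact hs0 ▸ hφ ha hs hs.1
  · right
    obtain ⟨s, hs, hs0⟩ := himg.symm.subset (mem_univ ⟨l, hl, le_rfl⟩)
    refine congrArg R (le_antisymm (φ a).2.2 ?_)
    exact hs0 ▸ hφ ha hs hs.1

/-- A concatenation of curves whose initial point is an endpoint of none of the curves is
constant. -/
theorem IsConcatenation.eq_of_forall_ne {X : Type*} [EMetricSpace X] {x y : X}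
    {γ : Path x y} {ι : Type*} {ℓ : ι → ℝ} (hℓ : ∀ i, 0 ≤ ℓ i) {R : ∀ i, C(Icc (0 : ℝ) (ℓ i), X)}
    (h : IsConcatenation γ R) (h0 : ∀ i, x ≠ R i ⟨0, le_rfl, hℓ i⟩)
    (h1 : ∀ i, x ≠ R i ⟨ℓ i, hℓ i, le_rfl⟩) : y = x := by
  obtain ⟨t, ht0, hmono, hlim, hstep⟩ := h
  -- Only the break points matter: a step that traverses a curve would make `x` one of its
  -- endpoints, so every step is a pause. The final point is reached by continuity.
  have hconst : ∀ n, γ (t n) = x := by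
    intro n
    induction n with
    | zero => rw [ht0, γ.source]
    | succ n ih =>
      have hn : t n ≤ t (n + 1) := hmono n.le_succ
      rcases hstep n with hp | ⟨i, hi⟩
      · rw [hp _ (right_mem_Icc.2 hn), ih]
      · rcases hi.apply_left hn (hℓ i) with h | h
        · exact absurd (ih.symm.trans h) (h0 i)
        · exact absurd (ih.symm.trans h) (h1 i)
  have hγ : Tendsto (fun n => γ (t n)) atTop (𝓝 (γ 1)) := (γ.continuous.tendsto 1).comp hlim
  simp only [hconst, γ.target] at hγ
  exact tendsto_nhds_unique hγ tendsto_const_nhds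

end LengthSpace

namespace StretchedGasket

open Set Filter Topology LengthSpace

/-- Minimality of the path plays no role: from a point off the corner cells, no concatenation of
edges at all reaches a vertex. -/
theorem not_lapidusSarhadAxiomTwo (α : Param) : ¬ LapidusSarhadAxiomTwo (edgeCurve α) := by
  rintro ⟨B, hB, h⟩
  obtain ⟨m, hm, hmc⟩ := exists_mem_gasket_notMem_cornerCells α
  obtain ⟨p, hpU, hpB⟩ := hB.inter_open_nonempty {p : gasket α | (p : Plane) ∉ cornerCells α}
    ((isClosed_cornerCells α).isOpen_compl.preimage continuous_subtype_val) ⟨⟨m, hm⟩, hmc⟩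
  obtain ⟨γ, -, hγ⟩ := h p hpB ⟨vertex 0, vertex_mem_gasket α 0⟩
  have heq := hγ.eq_of_forall_ne (fun e => (e.length_pos α).le) (fun e he => hpU ?_)
    fun e he => hpU ?_
  · refine hpU ?_
    rw [← heq]
    exact vertex_mem_cornerCells α 0
  · rw [he, edgeCurve_coe, zero_div, zero_smul, add_zero]
    exact e.start_mem_cornerCells α
  · rw [he, edgeCurve_coe, div_self (e.length_pos α).ne', one_smul, add_sub_cancel]
    exact e.finish_mem_cornerCells α

end StretchedGasket

end

theorem mainTheorem2 (α : Set.Ioo (0 : ℝ) (1 / 3)) :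
    (∀ x y : StretchedGasket.gasket α,
      LengthSpace.geodesicDist x y ≠ ⊤ ∧
      StretchedGasket.spectralDist α x y = LengthSpace.geodesicDist x y) ∧
    ¬ LengthSpace.LapidusSarhadAxiomTwo (StretchedGasket.edgeCurve α) :=
  ⟨fun x y => ⟨StretchedGasket.geodesicDist_ne_top α x y,
    le_antisymm (le_iInf fun γ => StretchedGasket.spectralDist_le_pathLength α γ)
      (StretchedGasket.geodesicDist_le_spectralDist α x y)⟩,
    StretchedGasket.not_lapidusSarhadAxiomTwo α⟩
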